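/- **Proposition.** Let $H$ be a complex Hilbert space and let $\mathcal{L}(H)$ be the Banach space of bounded linear operators on $H$. Let $$\mathcal{I}(H)=\{Q\in\mathcal{L}(H): Q^2=Q,\ Q\neq 0,\ Q\neq I\}$$ carry the Banach submanifold structure induced from $\mathcal{L}(H)$. Let $\mathscr{G}(H)$ be the Grassmann manifold of all non-zero proper complemented (i.e. closed) subspaces of $H$; for $E_0,F_0\in\mathscr{G}(H)$ that are complements of each other, its chart at $E_0$ along $F_0$ is the inverse of the bijection $T\mapsto (I+T)(E_0)$ from $\mathcal{L}(E_0,F_0)$ onto the set of all complements of $F_0$. Regard both as real analytic Banach manifolds, and let $\kappa:\mathcal{I}(H)\to\mathscr{G}(H)$ be given by $\kappa(Q)=Q(H)$. Then each fiber $\kappa^{-1}(E)$ can be given a complex Banach space structure, with underlying set $\kappa^{-1}(E)$, such that 1. the zero element of $\kappa^{-1}(E)$ is the orthogonal projection $P_E$ of $H$ onto $E$; 2. the inclusion $\kappa^{-1}(E)\to\mathcal{L}(H)$ is a complex affine isometry, so that the Banach space structure is isometrically affine isomorphic to the affine-Banach space structure that the fiber has as a subset of $\mathcal{L}(H)$;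 3. with these structures, $(\mathcal{I}(H),\mathscr{G}(H),\kappa)$ is a locally trivial real analytic complex Banach bundle. Here (3) means the following. The spaces $\mathcal{I}(H)$ and $\mathscr{G}(H)$ are Hausdorff real analytic Banach manifolds, $\kappa$ is a real analytic surjection, and the norm of each fiber induces the topology that the fiber has as a subspace of $\mathcal{I}(H)$. Moreover, there are, for every $E_0\in\mathscr{G}(H)$, an open neighborhood $V_{E_0}$ of $E_0$ and a real bi-analytic bijection $\Theta_{E_0}:V_{E_0}\times\kappa^{-1}(E_0)\to\kappa^{-1}(V_{E_0})$ such that, for every $E\in V_{E_0}$, $\Theta_{E_0}(E,\cdot)$ is a complex linear map of $\kappa^{-1}(E_0)$ onto $\kappa^{-1}(E)$; and for all $E_1,E_2\in\mathscr{G}(H)$ the map $$\varphi: V_{E_1}\cap V_{E_2}\to \mathcal{L}\big(\kappa^{-1}(E_1),\kappa^{-1}(E_2)\big),\qquad \varphi(E)(x)=\Pi_2\big(\Theta_{E_2}^{-1}(\Theta_{E_1}(E,x))\big),$$ is real analytic, where $\Pi_2$ is the projection onto the second coordinate. -/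

import Mathlib

open Set Topology

universe u

noncomputable section

/-! ### Banach manifolds

The charts of one manifold may take values in different Banach spaces. -/

/-- A chart of a set `M` with values in a Banach space: a bijection from a subset `source` of `M`
onto a subset `target` of the Banach space `model`. -/
structure BanachChart (𝕜 : Type) [NontriviallyNormedField 𝕜] (M : Type u) where
  model : Type u
  [normedAddCommGroup : NormedAddCommGroup model]
  [normedSpace : NormedSpace 𝕜 model]
  [completeSpace : CompleteSpace model]
  toPartialEquiv : PartialEquiv M model

attribute [instance] BanachChart.normedAddCommGroup BanachChart.normedSpace
  BanachChart.completeSpace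

namespace BanachChart

/-- The identity chart of a Banach space. -/
def self (𝕜 : Type) [NontriviallyNormedField 𝕜] (Y : Type u) [NormedAddCommGroup Y]
    [NormedSpace 𝕜 Y] [CompleteSpace Y] : BanachChart 𝕜 Y where
  model := Y
  toPartialEquiv := PartialEquiv.refl Y

/-- The product of two charts. -/
def prod {𝕜 : Type} [NontriviallyNormedField 𝕜] {M N : Type u} (c : BanachChart 𝕜 M)
    (d : BanachChart 𝕜 N) : BanachChart 𝕜 (M × N) where
  model := c.model × d.model
  toPartialEquiv := c.toPartialEquiv.prod d.toPartialEquiv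

/-- A complex chart, seen as a real chart. -/
def toReal {M : Type u} (c : BanachChart ℂ M) : BanachChart ℝ M where
  model := c.model
  normedSpace := NormedSpace.complexToReal
  toPartialEquiv := c.toPartialEquiv

end BanachChart

/-- The atlas of a Banach space, seen as a manifold. -/
def modelAtlas (𝕜 : Type) [NontriviallyNormedField 𝕜] (Y : Type u) [NormedAddCommGroup Y]
    [NormedSpace 𝕜 Y] [CompleteSpace Y] : Set (BanachChart 𝕜 Y) :=
  {BanachChart.self 𝕜 Y}

/-- The atlas of a product manifold. -/
def prodAtlas {𝕜 : Type} [NontriviallyNormedField 𝕜] {M N : Type u}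
    (A : Set (BanachChart 𝕜 M)) (B : Set (BanachChart 𝕜 N)) : Set (BanachChart 𝕜 (M × N)) :=
  image2 BanachChart.prod A B

/-- `A` is an analytic atlas of the topological space `M`: the charts are homeomorphisms between
open sets, they cover `M`, and the changes of charts are analytic. -/
structure IsAnalyticAtlas {𝕜 : Type} [NontriviallyNormedField 𝕜] {M : Type u}
    [TopologicalSpace M] (A : Set (BanachChart 𝕜 M)) : Prop where
  isOpen_source : ∀ c ∈ A, IsOpen c.toPartialEquiv.source
  isOpen_target : ∀ c ∈ A, IsOpen c.toPartialEquiv.target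
  continuousOn : ∀ c ∈ A, ContinuousOn c.toPartialEquiv c.toPartialEquiv.source
  continuousOn_symm : ∀ c ∈ A, ContinuousOn c.toPartialEquiv.symm c.toPartialEquiv.target
  cover : ∀ x : M, ∃ c ∈ A, x ∈ c.toPartialEquiv.source
  analytic : ∀ c ∈ A, ∀ d ∈ A,
    AnalyticOnNhd 𝕜 (d.toPartialEquiv ∘ c.toPartialEquiv.symm)
      (c.toPartialEquiv.target ∩ c.toPartialEquiv.symm ⁻¹' d.toPartialEquiv.source)

/-- The map `f` between two manifolds with atlases `A` and `B` is analytic on the open set `U`: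
it is continuous there, and it is analytic in all charts. -/
structure IsAnalyticMapOn {𝕜 : Type} [NontriviallyNormedField 𝕜] {M N : Type u}
    [TopologicalSpace M] [TopologicalSpace N] (A : Set (BanachChart 𝕜 M))
    (B : Set (BanachChart 𝕜 N)) (f : M → N) (U : Set M) : Prop where
  continuousOn : ContinuousOn f U
  analytic : ∀ c ∈ A, ∀ d ∈ B,
    AnalyticOnNhd 𝕜 (d.toPartialEquiv ∘ f ∘ c.toPartialEquiv.symm)
      (c.toPartialEquiv.target ∩
        c.toPartialEquiv.symm ⁻¹' (U ∩ f ⁻¹' d.toPartialEquiv.source))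

/-- The charts of the Banach submanifold structure on a subset `S` of a Banach space `Y`: those
charts `c` of `S` that come from an analytic diffeomorphism `φ` between open subsets of `Y` which
carries the part of `S` in its domain to the part of a complemented (hence closed) subspace in its
range.
The complemented subspace is the range of a split embedding `j` of the model space of `c`.
The set `S` is a submanifold if these charts cover `S`. -/
def submanifoldAtlas (𝕜 : Type) [NontriviallyNormedField 𝕜] {Y : Type u} [NormedAddCommGroup Y]
    [NormedSpace 𝕜 Y] (S : Set Y) : Set (BanachChart 𝕜 S) :=
  {c | ∃ (φ : OpenPartialHomeomorph Y Y) (j : c.model →L[𝕜] Y),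
    AnalyticOnNhd 𝕜 φ φ.source ∧ AnalyticOnNhd 𝕜 φ.symm φ.target ∧
    Function.Injective j ∧ j.range.ClosedComplemented ∧
    (∀ y ∈ φ.source, y ∈ S ↔ φ y ∈ range j) ∧
    c.toPartialEquiv.source = Subtype.val ⁻¹' φ.source ∧
    c.toPartialEquiv.target = j ⁻¹' φ.target ∧
    ∀ s ∈ c.toPartialEquiv.source, j (c.toPartialEquiv s) = φ s}

/-! ### Analytic Banach bundles -/

/-- The fiber `κ⁻¹(ω)`, as a bare type: it carries no topology until a norm is chosen on it. -/
def Fiber {T B : Type u} (κ : T → B) (ω : B) : Type u := {x : T // κ x = ω}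

/-- The inclusion of a fiber into the total space. -/
def Fiber.val {T B : Type u} {κ : T → B} {ω : B} (x : Fiber κ ω) : T := Subtype.val x

/-- `(T, B, κ)` is a locally trivial real analytic complex Banach bundle, where `AT` and `AB` are
the real analytic atlases of `T` and `B`, and where the fibers carry the given
complex Banach space structures.

`V ω₀` is the open neighborhood of `ω₀` over which `Θ ω₀` trivializes the bundle. -/
def IsRealAnalyticComplexBanachBundle {T B : Type u} [TopologicalSpace T] [TopologicalSpace B]
    (AT : Set (BanachChart ℝ T)) (AB : Set (BanachChart ℝ B)) (κ : T → B)
    [∀ ω, NormedAddCommGroup (Fiber κ ω)] [∀ ω, NormedSpace ℂ (Fiber κ ω)]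
    [∀ ω, CompleteSpace (Fiber κ ω)] : Prop :=
  T2Space T ∧ T2Space B ∧ IsAnalyticAtlas AT ∧ IsAnalyticAtlas AB ∧
  Function.Surjective κ ∧ IsAnalyticMapOn AT AB κ univ ∧
  -- the norm of a fiber induces the topology that the fiber has as a subspace of `T`
  (∀ ω, IsInducing (Fiber.val : Fiber κ ω → T)) ∧
  ∃ (V : B → Set B) (Θ : ∀ ω₀, PartialEquiv (B × Fiber κ ω₀) T),
    (∀ ω₀, IsOpen (V ω₀) ∧ ω₀ ∈ V ω₀ ∧
      (Θ ω₀).source = V ω₀ ×ˢ univ ∧ (Θ ω₀).target = κ ⁻¹' V ω₀ ∧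
      IsAnalyticMapOn (prodAtlas AB (modelAtlas ℝ (Fiber κ ω₀))) AT (Θ ω₀) (V ω₀ ×ˢ univ) ∧
      IsAnalyticMapOn AT (prodAtlas AB (modelAtlas ℝ (Fiber κ ω₀))) (Θ ω₀).symm (κ ⁻¹' V ω₀) ∧
      ∀ ω ∈ V ω₀, ∃ L : Fiber κ ω₀ →ₗ[ℂ] Fiber κ ω,
        Function.Surjective L ∧ ∀ x, Θ ω₀ (ω, x) = (L x).val) ∧
    ∀ ω₁ ω₂, ∃ φ : B → (Fiber κ ω₁ →L[ℂ] Fiber κ ω₂),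
      (∀ ω ∈ V ω₁ ∩ V ω₂, ∀ x, φ ω x = ((Θ ω₂).symm (Θ ω₁ (ω, x))).2) ∧
      IsAnalyticMapOn AB (modelAtlas ℝ (Fiber κ ω₁ →L[ℂ] Fiber κ ω₂)) φ (V ω₁ ∩ V ω₂)

/-! ### The Grassmann manifold -/

/-- The set of all non-zero proper complemented subspaces of `X`. -/
def Grassmannian (𝕜 : Type) [NontriviallyNormedField 𝕜] (X : Type u) [NormedAddCommGroup X]
    [NormedSpace 𝕜 X] : Type u :=
  {E : Submodule 𝕜 X // E.ClosedComplemented ∧ E ≠ ⊥ ∧ E ≠ ⊤}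

namespace Grassmannian

variable {𝕜 : Type} [NontriviallyNormedField 𝕜] {X : Type u} [NormedAddCommGroup X]
  [NormedSpace 𝕜 X]

/-- The subspace of `X` that an element of the Grassmannian is. -/
def space (E : Grassmannian 𝕜 X) : Submodule 𝕜 X := E.1

theorem isClosed (E : Grassmannian 𝕜 X) : IsClosed (E.space : Set X) := E.2.1.isClosed

instance [CompleteSpace X] (E : Grassmannian 𝕜 X) : CompleteSpace E.space :=
  E.isClosed.completeSpace_coe

/-- The map `I + T : E → X`, for `T : E → F`. -/
def graphMap (E F : Grassmannian 𝕜 X) (S : E.space →L[𝕜] F.space) : E.space →L[𝕜] X :=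
  E.space.subtypeL + F.space.subtypeL ∘L S

theorem isTopCompl_graph {E F : Grassmannian 𝕜 X} (h : E.space.IsTopCompl F.space)
    (S : E.space →L[𝕜] F.space) : (graphMap E F S).range.IsTopCompl F.space := by
  have := ContinuousLinearMap.isTopCompl_range_ker_of_leftInverse (graphMap E F S)
    (E.space.projectionOntoL F.space h) (fun x => by simp [graphMap])
  rwa [Submodule.ker_projectionOntoL] at this

/-- The complemented subspace `(I + T)(E)`, for `T : E → F` and a complement `F` of `E`. -/
def graph {E F : Grassmannian 𝕜 X} (h : E.space.IsTopCompl F.space)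
    (S : E.space →L[𝕜] F.space) : Grassmannian 𝕜 X :=
  ⟨(graphMap E F S).range, (isTopCompl_graph h S).closedComplemented,
    fun h0 => F.2.2.2 <| eq_top_of_bot_isCompl <| by
      have hc := (isTopCompl_graph h S).isCompl
      rwa [h0] at hc,
    fun h0 => F.2.2.1 <| eq_bot_of_top_isCompl <| by
      have hc := (isTopCompl_graph h S).isCompl
      rwa [h0] at hc⟩

open Classical in
/-- The map that sends a complement `G` of `F` to the operator `T : E → F` with
`(I + T)(E) = G`. -/
def slope (E F G : Grassmannian 𝕜 X) : E.space →L[𝕜] F.space :=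
  if h : G.space.IsTopCompl F.space then
    -(F.space.projectionOntoL G.space h.symm ∘L E.space.subtypeL)
  else 0

theorem graph_slope {E F G : Grassmannian 𝕜 X} (h : E.space.IsTopCompl F.space)
    (hG : G.space.IsTopCompl F.space) : graph h (slope E F G) = G := by
  apply Subtype.ext
  have hle : (graphMap E F (slope E F G)).range ≤ G.space := by
    rintro _ ⟨x, rfl⟩
    have hx := Submodule.projectionL_add_projectionL_eq_self hG (x : X)
    have : graphMap E F (slope E F G) x = G.space.projectionL F.space hG x := by
      rw [← eq_sub_iff_add_eq] at hx
      rw [hx]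
      simp [graphMap, slope, hG, sub_eq_add_neg]
    exact this ▸ Submodule.projectionL_apply_mem hG _
  have hc := (isTopCompl_graph h (slope E F G)).isCompl
  exact eq_of_le_of_inf_le_of_sup_le (z := F.space) hle
    (hG.isCompl.inf_eq_bot.le.trans bot_le) (le_top.trans hc.sup_eq_top.ge)

theorem slope_graph {E F : Grassmannian 𝕜 X} (h : E.space.IsTopCompl F.space)
    (S : E.space →L[𝕜] F.space) : slope E F (graph h S) = S := by
  have hS : (graph h S).space.IsTopCompl F.space := isTopCompl_graph h S
  ext x
  have hx : (x : X) = graphMap E F S x + ((-S x : F.space) : X) := by simp [graphMap]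
  have h1 : F.space.projectionOntoL (graph h S).space hS.symm (graphMap E F S x) = 0 :=
    Submodule.projectionOntoL_apply_eq_zero_of_mem_right hS.symm ⟨x, rfl⟩
  have h2 : F.space.projectionOntoL (graph h S).space hS.symm (x : X) = -S x := by
    rw [hx, map_add, h1, zero_add, Submodule.projectionOntoL_apply_left]
  simp only [slope, hS, dite_true, neg_apply,
    ContinuousLinearMap.comp_apply, Submodule.subtypeL_apply, h2, neg_neg]

/-- For complementary subspaces `E` and `F`, the bijection from the set of all complements of `F`
onto the Banach space of all continuous operators from `E` to `F`. -/
def chart [CompleteSpace X] {E F : Grassmannian 𝕜 X} (h : E.space.IsTopCompl F.space) :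
    BanachChart 𝕜 (Grassmannian 𝕜 X) where
  model := E.space →L[𝕜] F.space
  toPartialEquiv :=
    { toFun := slope E F
      invFun := graph h
      source := {G | G.space.IsTopCompl F.space}
      target := univ
      map_source' := fun _ _ => mem_univ _
      map_target' := fun S _ => isTopCompl_graph h S
      left_inv' := fun _ hG => graph_slope h hG
      right_inv' := fun S _ => slope_graph h S }

variable (𝕜 X) in
/-- The atlas of the Grassmann manifold. -/
def atlas [CompleteSpace X] : Set (BanachChart 𝕜 (Grassmannian 𝕜 X)) :=
  {c | ∃ (E F : Grassmannian 𝕜 X) (h : E.space.IsTopCompl F.space), c = chart h}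

/-- The topology of the Grassmann manifold: a set is open if all its preimages under the
inverses of the charts are open. -/
instance : TopologicalSpace (Grassmannian 𝕜 X) :=
  ⨆ (E : Grassmannian 𝕜 X) (F : Grassmannian 𝕜 X) (h : E.space.IsTopCompl F.space),
    TopologicalSpace.coinduced (graph h) inferInstance

end Grassmannian

/-! ### The idempotents -/

/-- The set of all idempotents of `X` except `0` and `I`, with the norm topology. -/
def idempotents (𝕜 : Type) [NontriviallyNormedField 𝕜] (X : Type u) [NormedAddCommGroup X]
    [NormedSpace 𝕜 X] : Set (X →L[𝕜] X) :=
  {Q | Q ≠ 0 ∧ Q ≠ 1 ∧ IsIdempotentElem Q}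

/-- The map `κ` that sends an idempotent to its range. -/
def rangeMap {𝕜 : Type} [NontriviallyNormedField 𝕜] {X : Type u} [NormedAddCommGroup X]
    [NormedSpace 𝕜 X] (Q : idempotents 𝕜 X) : Grassmannian 𝕜 X :=
  ⟨Q.1.range, (ContinuousLinearMap.IsIdempotentElem.isTopCompl Q.2.2.2).closedComplemented,
    fun h => Q.2.1 (by
      ext x
      have : Q.1 x ∈ Q.1.range := ⟨x, rfl⟩
      rw [h] at this
      simpa using this),
    fun h => Q.2.2.1 (by
      ext x
      obtain ⟨y, rfl⟩ : x ∈ Q.1.range := h ▸ Submodule.mem_top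
      exact DFunLike.congr_fun Q.2.2.2 y)⟩

end

/-! Both manifolds sit inside the Banach algebra of operators on $H$: the idempotents by inclusion,
the Grassmannian by `proj`, which sends $E$ to the orthogonal projection $P_E$. Each atlas is
induced by its embedding (`IsEmbeddedAtlas`), so a map between them is analytic as soon as it is
given by an analytic formula in operators (`IsEmbeddedAtlas.isAnalyticMapOn`). The charts then never
have to be computed with again.

For the idempotents, a block elimination relative to an idempotent $e$ (`straighten`) carries the
idempotents near $e$ into the off-diagonal operators. For the Grassmannian, let $Q$ be the
projection onto $E$ along $F$. Then $P_E-P_F$ and $Q+Q^*-1$ are inverse to each other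
(`Submodule.starProjection_sub_mul`), whence $Q=P_E(P_E-P_F)^{-1}$ and $P_E=Q(Q+Q^*-1)^{-1}$. The
first formula expresses the charts through $P_E$; the second gives their inverses and the map
$\kappa$. The adjoint in the second formula is what limits the argument to real analyticity.

The fiber over $E$ is the affine space $P_E+\{S: P_ES=S,\ SP_E=0\}$, and the norm is transported
from its closed direction. For $F$ near $E$ the operator $U=P_FP_E+(1-P_F)(1-P_E)$ is invertible and
$P_FU=UP_E$. Conjugation by $U$ therefore maps the fiber over $E$ onto that over $F$ and sends $P_E$
to $P_F$, so it is linear. It depends analytically on $P_F$, and the transition maps are $S\mapsto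
ASB$ with $A$, $B$ analytic in the base point, hence analytic in operator norm. -/

/-! ### Atlases induced by an embedding into a normed space -/

/-- The atlas `A` is the one induced by the map `ι` into a normed space `Y`: the charts extend to
analytic maps on open subsets of `Y`, and their inverses are analytic as maps into `Y`. -/
structure IsEmbeddedAtlas {M Y : Type u} [TopologicalSpace M] [NormedAddCommGroup Y]
    [NormedSpace ℝ Y] (ι : M → Y) (A : Set (BanachChart ℝ M)) : Prop where
  continuous : Continuous ι
  cover : ∀ x : M, ∃ c ∈ A, x ∈ c.toPartialEquiv.source
  isOpen_target : ∀ c ∈ A, IsOpen c.toPartialEquiv.target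
  continuousOn_symm : ∀ c ∈ A, ContinuousOn c.toPartialEquiv.symm c.toPartialEquiv.target
  analytic_symm : ∀ c ∈ A, AnalyticOnNhd ℝ (ι ∘ c.toPartialEquiv.symm) c.toPartialEquiv.target
  extend : ∀ c ∈ A, ∃ (U : Set Y) (Ψ : Y → c.model), IsOpen U ∧ AnalyticOnNhd ℝ Ψ U ∧
    c.toPartialEquiv.source = ι ⁻¹' U ∧ ∀ x, ι x ∈ U → c.toPartialEquiv x = Ψ (ι x)

namespace IsEmbeddedAtlas

variable {M N Y Z : Type u} [TopologicalSpace M] [TopologicalSpace N] [NormedAddCommGroup Y]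
  [NormedSpace ℝ Y] [NormedAddCommGroup Z] [NormedSpace ℝ Z] {ι : M → Y} {ι' : N → Z}
  {A : Set (BanachChart ℝ M)} {B : Set (BanachChart ℝ N)}

theorem isOpen_source (hA : IsEmbeddedAtlas ι A) {c : BanachChart ℝ M} (hc : c ∈ A) :
    IsOpen c.toPartialEquiv.source := by
  obtain ⟨U, Ψ, hU, -, hs, -⟩ := hA.extend c hc
  exact hs ▸ hU.preimage hA.continuous

/-- A map into an embedded manifold is continuous if its composition with the embedding is. -/
theorem continuousOn_of_comp (hB : IsEmbeddedAtlas ι' B) {f : M → N} {V : Set M} (hV : IsOpen V)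
    (hf : ContinuousOn (ι' ∘ f) V) : ContinuousOn f V := by
  intro x hx
  obtain ⟨d, hd, hxd⟩ := hB.cover (f x)
  obtain ⟨U, Ψ, hU, hΨ, hs, hdΨ⟩ := hB.extend d hd
  have hfx : ContinuousAt (ι' ∘ f) x := hf.continuousAt (hV.mem_nhds hx)
  have hxU : ι' (f x) ∈ U := by rwa [hs] at hxd
  have hmem : ∀ᶠ y in 𝓝 x, ι' (f y) ∈ U := hfx.eventually_mem (hU.mem_nhds hxU)
  -- Near `x` the map `f` factors as the inverse chart after `Ψ` after `ι' ∘ f`, and each factor is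
  -- continuous.
  have h1 : ContinuousAt (fun y => Ψ ((ι' ∘ f) y)) x :=
    ContinuousAt.comp (f := ι' ∘ f) (hΨ _ hxU).continuousAt hfx
  have ht : Ψ ((ι' ∘ f) x) ∈ d.toPartialEquiv.target := by
    rw [Function.comp_apply, ← hdΨ _ hxU]
    exact d.toPartialEquiv.map_source hxd
  have h2 : ContinuousAt (fun y => d.toPartialEquiv.symm (Ψ ((ι' ∘ f) y))) x :=
    ContinuousAt.comp (f := fun y => Ψ ((ι' ∘ f) y))
      ((hB.continuousOn_symm d hd).continuousAt ((hB.isOpen_target d hd).mem_nhds ht)) h1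
  refine (h2.congr ?_).continuousWithinAt
  filter_upwards [hmem] with y hy
  rw [Function.comp_apply, ← hdΨ _ hy]
  exact d.toPartialEquiv.left_inv (by rw [hs]; exact hy)

/-- A map between embedded manifolds is analytic if it extends to an analytic map between the
ambient spaces. -/
theorem isAnalyticMapOn (hA : IsEmbeddedAtlas ι A) (hB : IsEmbeddedAtlas ι' B) {f : M → N}
    {V : Set M} (hV : IsOpen V) {G : Y → Z} {O : Set Y} (hG : AnalyticOnNhd ℝ G O)
    (hVO : ∀ x ∈ V, ι x ∈ O) (hf : ∀ x ∈ V, ι' (f x) = G (ι x)) : IsAnalyticMapOn A B f V := by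
  have hcont : ContinuousOn f V := by
    refine hB.continuousOn_of_comp hV ?_
    exact (hG.continuousOn.comp hA.continuous.continuousOn hVO).congr hf
  refine ⟨hcont, fun c hc d hd => ?_⟩
  obtain ⟨U, Ψ, hU, hΨ, hs, hdΨ⟩ := hB.extend d hd
  have hopen : IsOpen (c.toPartialEquiv.target ∩
      c.toPartialEquiv.symm ⁻¹' (V ∩ f ⁻¹' d.toPartialEquiv.source)) :=
    (hA.continuousOn_symm c hc).isOpen_inter_preimage (hA.isOpen_target c hc)
      (hcont.isOpen_inter_preimage hV (hB.isOpen_source hd))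
  -- This composite is the expression of `f` in the charts `c` and `d`; all three factors are
  -- analytic in the ambient spaces.
  have key : AnalyticOnNhd ℝ (Ψ ∘ G ∘ (ι ∘ c.toPartialEquiv.symm)) (c.toPartialEquiv.target ∩
      c.toPartialEquiv.symm ⁻¹' (V ∩ f ⁻¹' d.toPartialEquiv.source)) := by
    refine hΨ.comp (hG.comp ((hA.analytic_symm c hc).mono inter_subset_left) ?_) ?_
    · exact fun v hv => hVO _ hv.2.1
    · intro v hv
      have h := hv.2.2
      rw [mem_preimage, hs, mem_preimage, hf _ hv.2.1] at h
      exact h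
  refine key.congr hopen ?_
  intro v hv
  have h := hv.2.2
  rw [mem_preimage, hs, mem_preimage] at h
  simp only [Function.comp_apply]
  rw [hdΨ _ h, hf _ hv.2.1]

/-- Changes of charts are the chart expressions of the identity of `M`, which extends to the
identity of the ambient space. -/
theorem isAnalyticAtlas (hA : IsEmbeddedAtlas ι A) : IsAnalyticAtlas A where
  isOpen_source _ hc := hA.isOpen_source hc
  isOpen_target := hA.isOpen_target
  continuousOn c hc := by
    obtain ⟨U, Ψ, hU, hΨ, hs, hcΨ⟩ := hA.extend c hc
    rw [hs]
    exact (hΨ.continuousOn.comp hA.continuous.continuousOn fun _ h => h).congr hcΨ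
  continuousOn_symm := hA.continuousOn_symm
  cover := hA.cover
  analytic c hc d hd := by
    have h := (hA.isAnalyticMapOn hA (f := id) isOpen_univ (analyticOnNhd_id (s := univ))
      (fun _ _ => mem_univ _) fun _ _ => rfl).analytic c hc d hd
    simpa using h

theorem prod (hA : IsEmbeddedAtlas ι A) (hB : IsEmbeddedAtlas ι' B) :
    IsEmbeddedAtlas (Prod.map ι ι') (prodAtlas A B) where
  continuous := hA.continuous.prodMap hB.continuous
  cover x := by
    obtain ⟨c, hc, hxc⟩ := hA.cover x.1
    obtain ⟨d, hd, hxd⟩ := hB.cover x.2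
    exact ⟨c.prod d, mem_image2_of_mem hc hd, hxc, hxd⟩
  isOpen_target := by
    rintro _ ⟨c, hc, d, hd, rfl⟩
    exact (hA.isOpen_target c hc).prod (hB.isOpen_target d hd)
  continuousOn_symm := by
    rintro _ ⟨c, hc, d, hd, rfl⟩
    exact (hA.continuousOn_symm c hc).prodMap (hB.continuousOn_symm d hd)
  analytic_symm := by
    rintro _ ⟨c, hc, d, hd, rfl⟩
    have h : AnalyticOnNhd ℝ (fun v : c.model × d.model =>
        ((ι ∘ c.toPartialEquiv.symm) v.1, (ι' ∘ d.toPartialEquiv.symm) v.2))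
        (c.toPartialEquiv.target ×ˢ d.toPartialEquiv.target) := fun v hv =>
      ((hA.analytic_symm c hc _ hv.1).fun_comp analyticAt_fst).prod
        ((hB.analytic_symm d hd _ hv.2).fun_comp analyticAt_snd)
    exact h
  extend := by
    rintro _ ⟨c, hc, d, hd, rfl⟩
    obtain ⟨U, Ψ, hU, hΨ, hs, hcΨ⟩ := hA.extend c hc
    obtain ⟨U', Ψ', hU', hΨ', hs', hdΨ⟩ := hB.extend d hd
    refine ⟨U ×ˢ U', Prod.map Ψ Ψ', hU.prod hU', ?_, ?_, ?_⟩
    · have h : AnalyticOnNhd ℝ (fun v : Y × Z => (Ψ v.1, Ψ' v.2)) (U ×ˢ U') := fun v hv =>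
        ((hΨ _ hv.1).fun_comp analyticAt_fst).prod ((hΨ' _ hv.2).fun_comp analyticAt_snd)
      exact h
    · change c.toPartialEquiv.source ×ˢ d.toPartialEquiv.source = _
      rw [hs, hs']
      rfl
    · exact fun x hx => Prod.ext (hcΨ _ hx.1) (hdΨ _ hx.2)

theorem model (Y : Type u) [NormedAddCommGroup Y] [NormedSpace ℝ Y] [CompleteSpace Y] :
    IsEmbeddedAtlas (id : Y → Y) (modelAtlas ℝ Y) where
  continuous := continuous_id
  cover x := ⟨_, mem_singleton _, mem_univ x⟩
  isOpen_target := by rintro _ rfl; exact isOpen_univ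
  continuousOn_symm := by rintro _ rfl; exact continuousOn_id
  analytic_symm := by rintro _ rfl; exact analyticOnNhd_id
  extend := by
    rintro _ rfl
    exact ⟨univ, id, isOpen_univ, analyticOnNhd_id, rfl, fun _ _ => rfl⟩

end IsEmbeddedAtlas

/-! ### Idempotents of a ring near a given one -/

section Ring

variable {R : Type*} [Ring R]

/-- The upper left block of `Y` with respect to the idempotent `e`, extended by the identity. -/
def upperBlock (e Y : R) : R := e * Y * e + (1 - e)

/-- The operator whose graph is the image of the range of `e` under `Y`. -/
noncomputable def rangeSlope (e Y : R) : R := (1 - e) * Y * e * Ring.inverse (upperBlock e Y)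

/-- Coordinates on `R` near the idempotent `e` in which the idempotents form a linear subspace. -/
noncomputable def straighten (e Y : R) : R :=
  -- In blocks relative to `e`, with $u=Y_{21}Y_{11}^{-1}$, the rows are $(Y_{11}+Y_{12}u-1,\
  -- Y_{12})$ and $(u,\ Y_{22}-uY_{12})$. The lower right entry is the Schur complement of $Y_{11}$.
  (1 - rangeSlope e Y) * Y + e * Y * rangeSlope e Y - e + rangeSlope e Y

/-- The inverse of `straighten`. -/
def unstraighten (e X : R) : R :=
  -- The second factor is block upper triangular with rows $(1+X_{11}-X_{12}X_{21},\ X_{12})$ and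
  -- $(0,\ X_{22})$; the first factor undoes the elimination.
  (1 + (1 - e) * X * e) * (e + X - (1 - e) * X * e - e * X * ((1 - e) * X * e))

variable {e Y X : R}

theorem mul_rangeSlope (he : IsIdempotentElem e) : e * rangeSlope e Y = 0 := by
  have : e * (1 - e) = 0 := he.mul_one_sub_self
  simp only [rangeSlope, ← mul_assoc, this, zero_mul]

/-- The upper block is block diagonal, so it commutes with `e`, and hence so does its inverse. -/
theorem rangeSlope_mul (he : IsIdempotentElem e) (hY : IsUnit (upperBlock e Y)) :
    rangeSlope e Y * e = rangeSlope e Y := by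
  have hc : Commute (upperBlock e Y) e := by
    have h : e * e = e := he
    change (e * Y * e + (1 - e)) * e = e * (e * Y * e + (1 - e))
    linear_combination (norm := noncomm_ring) e * Y * h - h * Y * e
  have ha : Ring.inverse (upperBlock e Y) * e = e * Ring.inverse (upperBlock e Y) := by
    calc _ = Ring.inverse (upperBlock e Y) * (e * upperBlock e Y) *
          Ring.inverse (upperBlock e Y) := by
          rw [mul_assoc, mul_assoc, Ring.mul_inverse_cancel _ hY, mul_one]
      _ = _ := by rw [← hc.eq, ← mul_assoc, Ring.inverse_mul_cancel _ hY, one_mul]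
  rw [rangeSlope, mul_assoc, ha, ← mul_assoc, mul_assoc _ e e, he.eq]

/-- This is the elimination property: multiplying by `1 - rangeSlope e Y` on the left clears the
lower left block of `Y`. -/
theorem rangeSlope_mul_mul (he : IsIdempotentElem e) (hY : IsUnit (upperBlock e Y)) :
    rangeSlope e Y * Y * e = (1 - e) * Y * e := by
  have h1 : rangeSlope e Y * upperBlock e Y = (1 - e) * Y * e := by
    rw [rangeSlope, mul_assoc, Ring.inverse_mul_cancel _ hY, mul_one]
  have h2 := rangeSlope_mul he hY
  rw [upperBlock] at h1
  linear_combination (norm := noncomm_ring) h1 - h2 * (Y * e) + h2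

/-- The first block column of `unstraighten e X` is $1+X_{21}$ times its upper left entry, so the
slope can be read off. -/
theorem rangeSlope_unstraighten (he : IsIdempotentElem e)
    (h : IsUnit (upperBlock e (unstraighten e X))) :
    rangeSlope e (unstraighten e X) = (1 - e) * X * e := by
  have he' : ∀ x, e * (e * x) = e * x := fun x => by rw [← mul_assoc, he.eq]
  have h1 : (1 - e) * unstraighten e X * e =
      (1 - e) * X * e * upperBlock e (unstraighten e X) := by
    simp only [unstraighten, upperBlock, mul_add, add_mul, mul_sub, sub_mul, mul_assoc, he.eq, he',
      one_mul, mul_one]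
    abel
  rw [rangeSlope, h1, mul_assoc, Ring.mul_inverse_cancel _ h, mul_one]

theorem straighten_unstraighten (he : IsIdempotentElem e)
    (h : IsUnit (upperBlock e (unstraighten e X))) : straighten e (unstraighten e X) = X := by
  have he' : ∀ x, e * (e * x) = e * x := fun x => by rw [← mul_assoc, he.eq]
  rw [straighten, rangeSlope_unstraighten he h]
  simp only [unstraighten, mul_add, add_mul, mul_sub, sub_mul, mul_assoc, he.eq, he', one_mul]
  abel

theorem unstraighten_straighten (he : IsIdempotentElem e) (hY : IsUnit (upperBlock e Y)) :
    unstraighten e (straighten e Y) = Y := by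
  have he' : ∀ x, e * (e * x) = e * x := fun x => by rw [← mul_assoc, he.eq]
  have hu := mul_rangeSlope (Y := Y) he
  have hu' : ∀ x, e * (rangeSlope e Y * x) = 0 := fun x => by rw [← mul_assoc, hu, zero_mul]
  have hv := rangeSlope_mul he hY
  have hv' : ∀ x, rangeSlope e Y * (e * x) = rangeSlope e Y * x := fun x => by
    rw [← mul_assoc, hv]
  have hw : rangeSlope e Y * rangeSlope e Y = 0 := by rw [← hv, mul_assoc, hu', mul_zero]
  have hw' : ∀ x, rangeSlope e Y * (rangeSlope e Y * x) = 0 := fun x => by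
    rw [← mul_assoc, hw, zero_mul]
  have hYe := rangeSlope_mul_mul he hY
  have hX : (1 - e) * straighten e Y * e = rangeSlope e Y := by
    rw [sub_mul, sub_mul, one_mul, mul_assoc] at hYe
    simp only [straighten, mul_add, add_mul, mul_sub, sub_mul, mul_assoc, he.eq, he', hu, hu',
      hv, hYe, one_mul]
    abel
  rw [unstraighten, hX]
  simp only [straighten, mul_add, add_mul, mul_sub, sub_mul, mul_assoc, he.eq, he', hu, hu',
      hv, hv', hw, hw', one_mul, mul_zero]
  abel

/-- The lower right block of `straighten e Y` is idempotent if `Y` is. -/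
theorem isIdempotentElem_lowerBlock (he : IsIdempotentElem e) (hY : IsUnit (upperBlock e Y))
    (hi : IsIdempotentElem Y) :
    IsIdempotentElem ((1 - e) * straighten e Y * (1 - e)) := by
  have hu := mul_rangeSlope (Y := Y) he
  have hv := rangeSlope_mul he hY
  have hYe := rangeSlope_mul_mul he hY
  have he' : ∀ x, e * (e * x) = e * x := fun x => by rw [← mul_assoc, he.eq]
  have hu' : ∀ x, e * (rangeSlope e Y * x) = 0 := fun x => by rw [← mul_assoc, hu, zero_mul]
  have hs : (1 - e) * straighten e Y * (1 - e) = (1 - e - rangeSlope e Y) * Y := by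
    simp only [sub_mul, one_mul, mul_assoc] at hYe
    simp only [straighten, mul_add, add_mul, mul_sub, sub_mul, mul_assoc, he.eq, he', hu, hu',
      hv, hYe, one_mul, mul_one]
    abel
  have hse : (1 - e - rangeSlope e Y) * Y * e = 0 := by
    rw [sub_mul, sub_mul, hYe, sub_self]
  have hsu : (1 - e - rangeSlope e Y) * Y * rangeSlope e Y = 0 := by
    have : rangeSlope e Y = (1 - e) * Y * e * Ring.inverse (upperBlock e Y) := rfl
    have h2 : (1 - e - rangeSlope e Y) * Y * (1 - e) = (1 - e - rangeSlope e Y) * Y := by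
      rw [mul_sub, hse, mul_one, sub_zero]
    -- Write $s$ for the lower block, which equals `(1 - e - rangeSlope e Y) * Y`. Since $se=0$, the
    -- factor $1-e$ is absorbed; since $sY=s$ by idempotency of `Y`, what remains contains $se=0$.
    calc _ = (1 - e - rangeSlope e Y) * Y * (1 - e) * Y * e * Ring.inverse (upperBlock e Y) := by
          refine (congrArg ((1 - e - rangeSlope e Y) * Y * ·) this).trans ?_
          simp only [mul_assoc]
      _ = _ := by rw [h2, mul_assoc _ Y Y, hi.eq, hse, zero_mul]
  rw [hs, IsIdempotentElem]
  calc _ = (1 - e - rangeSlope e Y) * Y * Y - (1 - e - rangeSlope e Y) * Y * e * Y -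
        (1 - e - rangeSlope e Y) * Y * rangeSlope e Y * Y := by noncomm_ring
    _ = _ := by rw [hse, hsu, zero_mul, sub_zero, sub_zero, mul_assoc, hi.eq]

/-- The upper left block of `straighten e Y` vanishes if `Y` is idempotent. -/
theorem upperBlock_straighten_eq_zero (he : IsIdempotentElem e) (hY : IsUnit (upperBlock e Y))
    (hi : IsIdempotentElem Y) : e * straighten e Y * e = 0 := by
  have hu := mul_rangeSlope (Y := Y) he
  have hv := rangeSlope_mul he hY
  have he' : ∀ x, e * (e * x) = e * x := fun x => by rw [← mul_assoc, he.eq]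
  have hu' : ∀ x, e * (rangeSlope e Y * x) = 0 := fun x => by rw [← mul_assoc, hu, zero_mul]
  have hs : e * straighten e Y * e = e * Y * e + e * Y * rangeSlope e Y - e := by
    simp only [straighten, mul_add, add_mul, mul_sub, sub_mul, mul_assoc, he.eq, he', hu, hu',
      hv, one_mul]
    abel
  have h1 : rangeSlope e Y * upperBlock e Y = (1 - e) * Y * e := by
    rw [rangeSlope, mul_assoc, Ring.inverse_mul_cancel _ hY, mul_one]
  -- After right multiplication by the invertible upper block, the claim becomes
  -- $Y_{11}^2+Y_{12}Y_{21}=Y_{11}$, the upper left block of $Y^2=Y$.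
  rw [hs, ← hY.mul_left_inj, zero_mul]
  have h2 : e * Y * rangeSlope e Y * upperBlock e Y = e * Y * ((1 - e) * Y * e) := by
    rw [mul_assoc, h1]
  have hi' : ∀ x, Y * (Y * x) = Y * x := fun x => by rw [← mul_assoc, hi.eq]
  rw [sub_mul, add_mul, h2]
  simp only [upperBlock, mul_add, mul_sub, sub_mul, mul_assoc, he.eq, he', hi', one_mul,
    mul_one]
  abel

/-- If both diagonal blocks of `straighten e Y` vanish, then `Y` is idempotent. -/
theorem isIdempotentElem_of_straighten (he : IsIdempotentElem e) (hY : IsUnit (upperBlock e Y))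
    (h₁ : e * straighten e Y * e = 0) (h₂ : (1 - e) * straighten e Y * (1 - e) = 0) :
    IsIdempotentElem Y := by
  have he' : ∀ x, e * (e * x) = e * x := fun x => by rw [← mul_assoc, he.eq]
  rw [← unstraighten_straighten he hY]
  generalize straighten e Y = X at h₁ h₂
  have hX : X = e * X + X * e := by
    linear_combination (norm := noncomm_ring) h₂ - h₁
  have hu : (1 - e) * X * e = X * e := by rw [sub_mul, sub_mul, one_mul, h₁, sub_zero]
  have hβ : X - X * e = e * X := by rw [sub_eq_iff_eq_add, ← hX]
  have h₃ : e * (X * e) = 0 := by rw [← mul_assoc, h₁]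
  have h₄ : ∀ x, e * (X * (e * x)) = 0 := fun x => by
    rw [← mul_assoc, ← mul_assoc, h₁, zero_mul]
  have hβ' : e * X * (X * e) = e * (X * (X * e)) := mul_assoc _ _ _
  -- With this factorization $Y=RC$, the next two identities say $CR=e+eX$ and $(e+eX)C=C$, so
  -- $Y^2=R(CR)C=RC=Y$.
  have hY' : unstraighten e X = (1 + X * e) * (e + e * X - e * X * (X * e)) := by
    rw [unstraighten, hu, add_sub_assoc e, hβ]
  have h₅ : (e + e * X - e * X * (X * e)) * (1 + X * e) = e + e * X := by
    simp only [mul_add, add_mul, sub_mul, mul_assoc, h₃, mul_one, mul_zero]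
    abel
  have h₆ : (e + e * X) * (e + e * X - e * X * (X * e)) = e + e * X - e * X * (X * e) := by
    simp only [mul_add, add_mul, mul_sub, mul_assoc, h₃, h₄, he', he.eq]
    abel
  rw [hY', IsIdempotentElem, mul_assoc, ← mul_assoc (e + e * X - e * X * (X * e)), h₅, h₆]

end Ring

/-! ### Analytic straightening of idempotents in a normed algebra -/

section Analytic

variable {𝕜 : Type*} [NontriviallyNormedField 𝕜] {R : Type u} [NormedRing R] [NormedAlgebra 𝕜 R]
  {e : R}

theorem continuous_upperBlock (e : R) : Continuous (upperBlock e) := by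
  unfold upperBlock; fun_prop

theorem continuous_unstraighten (e : R) : Continuous (unstraighten e) := by
  unfold unstraighten; fun_prop

variable (𝕜) in
theorem analyticOnNhd_unstraighten (e : R) (s : Set R) : AnalyticOnNhd 𝕜 (unstraighten e) s := by
  intro X _
  unfold unstraighten
  fun_prop

variable (𝕜) in
/-- The projection of `R` onto the off-diagonal blocks with respect to `e`. -/
noncomputable def offDiagonal (e : R) : R →L[𝕜] R :=
  ContinuousLinearMap.mulLeftRight 𝕜 R e (1 - e) + ContinuousLinearMap.mulLeftRight 𝕜 R (1 - e) e

theorem offDiagonal_apply (X : R) : offDiagonal 𝕜 e X = e * X * (1 - e) + (1 - e) * X * e := rfl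

theorem isIdempotentElem_offDiagonal (he : IsIdempotentElem e) :
    IsIdempotentElem (offDiagonal 𝕜 e) := by
  have he' : ∀ x, e * (e * x) = e * x := fun x => by rw [← mul_assoc, he.eq]
  ext X
  simp only [mul_apply_eq_comp, offDiagonal_apply, mul_add, add_mul, mul_sub, sub_mul,
    mul_assoc, he.eq, he', one_mul, mul_one]
  abel

theorem mem_range_offDiagonal_iff (he : IsIdempotentElem e) {X : R} :
    X ∈ (offDiagonal 𝕜 e).range ↔ e * X * e = 0 ∧ (1 - e) * X * (1 - e) = 0 := by
  have he' : ∀ x, e * (e * x) = e * x := fun x => by rw [← mul_assoc, he.eq]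
  constructor
  · rintro ⟨X, rfl⟩
    constructor <;>
    · simp only [ContinuousLinearMap.coe_coe, offDiagonal_apply, mul_add, add_mul, mul_sub,
        sub_mul, mul_assoc, he.eq, he', one_mul, mul_one]
      abel
  · rintro ⟨h₁, h₂⟩
    refine ⟨X, ?_⟩
    rw [ContinuousLinearMap.coe_coe, offDiagonal_apply]
    linear_combination (norm := noncomm_ring) - h₁ - h₂

variable [CompleteSpace R]

theorem AnalyticAt.ringInverse {Z : Type*} [NormedAddCommGroup Z] [NormedSpace 𝕜 Z] {f : Z → R}
    {z : Z} (hf : AnalyticAt 𝕜 f z) (hz : IsUnit (f z)) :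
    AnalyticAt 𝕜 (fun z => Ring.inverse (f z)) z :=
  AnalyticAt.fun_comp (g := Ring.inverse) (analyticOnNhd_inverse _ hz) hf

variable (𝕜) in
theorem analyticOnNhd_straighten (e : R) :
    AnalyticOnNhd 𝕜 (straighten e) {Y | IsUnit (upperBlock e Y)} := by
  intro Y hY
  have h1 : AnalyticAt 𝕜 (upperBlock e) Y := by unfold upperBlock; fun_prop
  have h2 : AnalyticAt 𝕜 (fun Y => Ring.inverse (upperBlock e Y)) Y :=
    h1.ringInverse hY
  have h3 : AnalyticAt 𝕜 (rangeSlope e) Y := by unfold rangeSlope; fun_prop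
  unfold straighten
  fun_prop

variable (𝕜) in
/-- Near the idempotent `e`, the map `straighten e` is a homeomorphism. -/
noncomputable def straightenHomeomorph (he : IsIdempotentElem e) : OpenPartialHomeomorph R R where
  toFun := straighten e
  invFun := unstraighten e
  -- The second condition keeps one minus the Schur complement invertible. It holds near `e`, and it
  -- forces an idempotent Schur complement to vanish.
  source := {Y | IsUnit (upperBlock e Y)} ∩
    straighten e ⁻¹' {X | IsUnit (1 - (1 - e) * X * (1 - e))}
  target := {X | IsUnit (upperBlock e (unstraighten e X))} ∩
    {X | IsUnit (1 - (1 - e) * X * (1 - e))}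
  map_source' Y hY := by
    refine ⟨?_, hY.2⟩
    rw [mem_ofPred_eq, unstraighten_straighten he hY.1]
    exact hY.1
  map_target' X hX := by
    refine ⟨hX.1, ?_⟩
    rw [mem_preimage, straighten_unstraighten he hX.1]
    exact hX.2
  left_inv' Y hY := unstraighten_straighten he hY.1
  right_inv' X hX := straighten_unstraighten he hX.1
  open_source := by
    refine (analyticOnNhd_straighten 𝕜 e).continuousOn.isOpen_inter_preimage ?_ ?_
    · exact Units.isOpen.preimage (continuous_upperBlock e)
    · exact Units.isOpen.preimage (by fun_prop : Continuous fun X : R => 1 - (1 - e) * X * (1 - e))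
  open_target := by
    refine (Units.isOpen.preimage ((continuous_upperBlock e).comp (continuous_unstraighten e))).inter
      (Units.isOpen.preimage (by fun_prop : Continuous fun X : R => 1 - (1 - e) * X * (1 - e)))
  continuousOn_toFun := (analyticOnNhd_straighten 𝕜 e).continuousOn.mono inter_subset_left
  continuousOn_invFun := (continuous_unstraighten e).continuousOn

/-- The set of all idempotents of `R` except `0` and `1` is a submanifold: near `e`, the map
`straighten e` carries it to a linear subspace. -/
theorem mem_idempotents_iff_straighten (he : IsIdempotentElem e) (h0 : e ≠ 0) (h1 : e ≠ 1) {Y : R}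
    (hY : Y ∈ (straightenHomeomorph 𝕜 he).source) :
    (Y ≠ 0 ∧ Y ≠ 1 ∧ IsIdempotentElem Y) ↔
      straightenHomeomorph 𝕜 he Y ∈ (offDiagonal 𝕜 e).range := by
  change _ ↔ straighten e Y ∈ _
  rw [mem_range_offDiagonal_iff he]
  constructor
  · rintro ⟨-, -, hi⟩
    refine ⟨upperBlock_straighten_eq_zero he hY.1 hi, ?_⟩
    have h := isIdempotentElem_lowerBlock he hY.1 hi
    have hu : IsUnit (1 - (1 - e) * straighten e Y * (1 - e)) := hY.2
    -- The lower block $s$ satisfies $s(1-s)=0$ with $1-s$ invertible, so $s=0$.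
    rw [← hu.mul_left_inj, zero_mul]
    exact h.mul_one_sub_self
  · rintro ⟨h₁, h₂⟩
    refine ⟨?_, ?_, isIdempotentElem_of_straighten he hY.1 h₁ h₂⟩
    -- At `Y = 0` the upper block is $1-e$; its invertibility would give $e=0$.
    · rintro rfl
      have h : IsUnit (upperBlock e 0) := hY.1
      rw [upperBlock, mul_zero, zero_mul, zero_add] at h
      exact h0 (by rw [← h.mul_left_inj, he.mul_one_sub_self, zero_mul])
    -- At `Y = 1` the slope is zero and the lower block of `straighten e 1` is $1-e$; its vanishing
    -- would give $e=1$.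
    · rintro rfl
      have hs : rangeSlope e 1 = 0 := by
        rw [rangeSlope, mul_one, he.one_sub_mul_self, zero_mul]
      rw [straighten, hs] at h₂
      have h : (1 - e) * (1 - e) = 1 - e := he.one_sub
      simp only [sub_zero, mul_one, mul_zero, add_zero, h] at h₂
      exact h1 (sub_eq_zero.mp h₂).symm

theorem mem_source_straightenHomeomorph (he : IsIdempotentElem e) :
    e ∈ (straightenHomeomorph 𝕜 he).source := by
  have hu : upperBlock e e = 1 := by rw [upperBlock, he.eq, he.eq]; abel
  have hs : rangeSlope e e = 0 := by
    rw [rangeSlope, he.one_sub_mul_self, zero_mul, zero_mul]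
  refine ⟨?_, ?_⟩
  · rw [mem_ofPred_eq, hu]; exact isUnit_one
  · rw [mem_preimage, mem_ofPred_eq, straighten, hs]
    simp

end Analytic

/-! ### Charts of submanifolds of a Banach space -/

/-- A split embedding `j` and an analytic diffeomorphism `φ` that straightens `S` give a chart. -/
theorem exists_mem_submanifoldAtlas {𝕜 : Type} [NontriviallyNormedField 𝕜] {Y : Type u}
    [NormedAddCommGroup Y] [NormedSpace 𝕜 Y] [CompleteSpace Y] {S : Set Y}
    (φ : OpenPartialHomeomorph Y Y) (hφ : AnalyticOnNhd 𝕜 φ φ.source)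
    (hφ' : AnalyticOnNhd 𝕜 φ.symm φ.target) {p : Y →L[𝕜] Y} (hp : IsIdempotentElem p)
    (hS : ∀ y ∈ φ.source, y ∈ S ↔ φ y ∈ p.range) {y : Y} (hyS : y ∈ S) (hy : y ∈ φ.source) :
    ∃ c ∈ submanifoldAtlas 𝕜 S, ⟨y, hyS⟩ ∈ c.toPartialEquiv.source := by
  classical
  have hpc : p.range.ClosedComplemented :=
    (ContinuousLinearMap.IsIdempotentElem.isTopCompl hp).closedComplemented
  have : CompleteSpace p.range := hpc.isClosed.completeSpace_coe
  have hpp : ∀ v ∈ p.range, p v = v := by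
    rintro _ ⟨w, rfl⟩
    exact DFunLike.congr_fun hp w
  have hmem : ∀ v : p.range, (v : Y) ∈ φ.target → φ.symm v ∈ S := fun v hv =>
    (hS _ (φ.map_target hv)).2 (by rw [φ.right_inv hv]; exact v.2)
  let c : BanachChart 𝕜 S :=
    { model := p.range
      toPartialEquiv :=
        { toFun := fun s => ⟨p (φ s), ⟨_, rfl⟩⟩
          -- Outside the target the value is irrelevant; the base point `y` only serves as an
          -- available element of `S`.
          invFun := fun v => if h : (v : Y) ∈ φ.target then ⟨φ.symm v, hmem v h⟩ else ⟨y, hyS⟩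
          source := Subtype.val ⁻¹' φ.source
          target := p.range.subtypeL ⁻¹' φ.target
          map_source' := fun s hs => by
            change p (φ s) ∈ φ.target
            rw [hpp _ ((hS s hs).1 s.2)]
            exact φ.map_source hs
          map_target' := fun v hv => by
            have hv' : (v : Y) ∈ φ.target := hv
            simp only [hv', dite_true]
            exact φ.map_target hv'
          left_inv' := fun s hs => by
            have h : p (φ s) = φ s := hpp _ ((hS s hs).1 s.2)
            have h2 : φ s ∈ φ.target := φ.map_source hs
            apply Subtype.ext
            simp only [h, h2, dite_true]
            exact φ.left_inv hs
          right_inv' := fun v hv => by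
            have hv' : (v : Y) ∈ φ.target := hv
            apply Subtype.ext
            simp only [hv', dite_true, φ.right_inv hv']
            exact hpp _ v.2 } }
  refine ⟨c, ⟨φ, p.range.subtypeL, hφ, hφ', Subtype.val_injective, ?_, ?_, rfl, rfl, ?_⟩, hy⟩
  · have : p.range.subtypeL.range = p.range := Submodule.range_subtype _
    rwa [this]
  · intro z hz
    rw [hS z hz]
    exact ⟨fun h => ⟨⟨_, h⟩, rfl⟩, fun ⟨v, hv⟩ => hv ▸ v.2⟩
  · intro s hs
    exact hpp _ ((hS s hs).1 s.2)

/-- The idempotents are covered by submanifold charts. -/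
theorem exists_mem_submanifoldAtlas_idempotents {𝕜 : Type} [NontriviallyNormedField 𝕜]
    {X : Type u} [NormedAddCommGroup X] [NormedSpace 𝕜 X] [CompleteSpace X]
    (Q : idempotents 𝕜 X) :
    ∃ c ∈ submanifoldAtlas 𝕜 (idempotents 𝕜 X), Q ∈ c.toPartialEquiv.source := by
  have hQ : IsIdempotentElem Q.1 := Q.2.2.2
  exact exists_mem_submanifoldAtlas (straightenHomeomorph 𝕜 hQ)
    ((analyticOnNhd_straighten 𝕜 Q.1).mono inter_subset_left)
    (analyticOnNhd_unstraighten 𝕜 Q.1 _) (isIdempotentElem_offDiagonal hQ)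
    (fun Y hY => mem_idempotents_iff_straighten hQ Q.2.1 Q.2.2.1 hY) Q.2
    (mem_source_straightenHomeomorph hQ)

/-- The atlas of a submanifold is induced by the inclusion. -/
theorem isEmbeddedAtlas_submanifoldAtlas {Y : Type u} [NormedAddCommGroup Y] [NormedSpace ℂ Y]
    [CompleteSpace Y] {S : Set Y}
    (hS : ∀ y : S, ∃ c ∈ submanifoldAtlas ℂ S, y ∈ c.toPartialEquiv.source) :
    IsEmbeddedAtlas (Subtype.val : S → Y) (BanachChart.toReal '' submanifoldAtlas ℂ S) := by
  have key : ∀ c ∈ submanifoldAtlas ℂ S, IsOpen c.toPartialEquiv.target ∧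
      AnalyticOnNhd ℂ (Subtype.val ∘ c.toPartialEquiv.symm : c.model → Y)
        c.toPartialEquiv.target ∧
      ∃ (U : Set Y) (Ψ : Y → c.model), IsOpen U ∧ AnalyticOnNhd ℂ Ψ U ∧
        c.toPartialEquiv.source = Subtype.val ⁻¹' U ∧
        ∀ x : S, (x : Y) ∈ U → c.toPartialEquiv x = Ψ x := by
    rintro c ⟨φ, j, hφ, hφ', hj, hjc, -, hs, ht, hjφ⟩
    have htop : IsOpen c.toPartialEquiv.target := ht ▸ φ.open_target.preimage j.continuous
    refine ⟨htop, ?_, φ.source, ?_⟩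
    · have h : AnalyticOnNhd ℂ (φ.symm ∘ j) c.toPartialEquiv.target :=
        hφ'.comp (j.analyticOnNhd _) fun v hv => by rwa [ht] at hv
      refine h.congr htop fun v hv => ?_
      have h1 := c.toPartialEquiv.map_target hv
      have h2 := hjφ _ h1
      rw [c.toPartialEquiv.right_inv hv] at h2
      rw [Function.comp_apply, Function.comp_apply, h2, φ.left_inv]
      rwa [hs] at h1
    -- Because the range of `j` is complemented, `j` has a continuous left inverse; following `φ` by
    -- it extends the chart to the ambient open set.
    · have hl : j.HasLeftInverse :=
        ContinuousLinearMap.HasLeftInverse.of_injective_of_isClosed_range_of_closedComplement_range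
          hj hjc.isClosed hjc
      refine ⟨hl.leftInverse ∘ φ, φ.open_source,
        (hl.leftInverse.analyticOnNhd univ).comp hφ fun _ _ => mem_univ _, hs, fun x hx => ?_⟩
      rw [Function.comp_apply, ← hjφ x (by rw [hs]; exact hx), hl.leftInverse_leftInverse]
  refine ⟨continuous_subtype_val, ?_, ?_, ?_, ?_, ?_⟩
  · intro x
    obtain ⟨c, hc, hx⟩ := hS x
    exact ⟨_, mem_image_of_mem _ hc, hx⟩
  · rintro _ ⟨c, hc, rfl⟩
    exact (key c hc).1
  · rintro _ ⟨c, hc, rfl⟩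
    exact IsInducing.subtypeVal.continuousOn_iff.2 (key c hc).2.1.continuousOn
  · rintro _ ⟨c, hc, rfl⟩
    have h : AnalyticOnNhd ℝ (Subtype.val ∘ c.toPartialEquiv.symm : c.model → Y)
        c.toPartialEquiv.target := fun v hv => ((key c hc).2.1 v hv).restrictScalars
    exact h
  · rintro _ ⟨c, hc, rfl⟩
    obtain ⟨-, -, U, Ψ, hU, hΨ, hs, hc'⟩ := key c hc
    have h : AnalyticOnNhd ℝ Ψ U := fun v hv => (hΨ v hv).restrictScalars
    exact ⟨U, Ψ, hU, h, hs, hc'⟩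

/-! ### Orthogonal and oblique projections of a Hilbert space -/

section Projections

variable {H : Type u} [NormedAddCommGroup H] [InnerProductSpace ℂ H]

theorem Submodule.starProjection_mul_of_forall_mem {E : Submodule ℂ H} [E.HasOrthogonalProjection]
    {A : H →L[ℂ] H} (hA : ∀ x, A x ∈ E) : E.starProjection * A = A := by
  ext x
  exact Submodule.starProjection_eq_self_iff.2 (hA x)

theorem Submodule.mul_starProjection_of_forall_mem {E : Submodule ℂ H} [E.HasOrthogonalProjection]
    {A B : H →L[ℂ] H} (hA : ∀ x ∈ E, A x = B x) : A * E.starProjection = B * E.starProjection := by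
  ext x
  exact hA _ (E.starProjection_apply_mem x)

variable {E F : Submodule ℂ H}

theorem Submodule.starProjection_mul_projectionL [E.HasOrthogonalProjection]
    (h : E.IsTopCompl F) :
    E.starProjection * E.projectionL F h = E.projectionL F h :=
  starProjection_mul_of_forall_mem fun x => projectionL_apply_mem h x

theorem Submodule.projectionL_mul_starProjection [E.HasOrthogonalProjection]
    (h : E.IsTopCompl F) :
    E.projectionL F h * E.starProjection = E.starProjection := by
  rw [mul_starProjection_of_forall_mem (B := 1) fun x hx => projectionL_apply_left h ⟨x, hx⟩,
    one_mul]

theorem Submodule.projectionL_mul_starProjection_right [F.HasOrthogonalProjection]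
    (h : E.IsTopCompl F) :
    E.projectionL F h * F.starProjection = 0 := by
  rw [mul_starProjection_of_forall_mem (B := 0) fun x hx => projectionL_apply_right h ⟨x, hx⟩,
    zero_mul]

/-- The complementary projection $1-Q$ takes values in `F`, so it is fixed by $P_F$ on the left. -/
theorem Submodule.starProjection_right_mul_projectionL [F.HasOrthogonalProjection]
    (h : E.IsTopCompl F) :
    F.starProjection * E.projectionL F h = F.starProjection - 1 + E.projectionL F h := by
  have h1 : F.starProjection * (1 - E.projectionL F h) = 1 - E.projectionL F h := by
    refine starProjection_mul_of_forall_mem fun x => ?_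
    have : (1 - E.projectionL F h) x = F.projectionL E h.symm x :=
      (projectionL_eq_self_sub_projectionL h x).symm
    rw [this]
    exact projectionL_apply_mem h.symm x
  rw [mul_sub, mul_one] at h1
  linear_combination (norm := abel) -h1

variable [CompleteSpace H]

theorem Submodule.star_starProjection (E : Submodule ℂ H) [E.HasOrthogonalProjection] :
    star E.starProjection = E.starProjection := isSelfAdjoint_starProjection E

variable [E.HasOrthogonalProjection] [F.HasOrthogonalProjection]

/-- From $P_EQ=Q$ and $P_EQ^*=(QP_E)^*=P_E$ one gets $P_E(Q+Q^*-1)=Q$. From $P_FQ=P_F-1+Q$ and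
$P_FQ^*=(QP_F)^*=0$ one gets $P_F(Q+Q^*-1)=Q-1$. The difference is $1$. -/
theorem Submodule.starProjection_sub_mul (h : E.IsTopCompl F) :
    (E.starProjection - F.starProjection) *
      (E.projectionL F h + star (E.projectionL F h) - 1) = 1 := by
  have h1 := congrArg star (projectionL_mul_starProjection h)
  have h2 := congrArg star (projectionL_mul_starProjection_right h)
  rw [star_mul, star_starProjection] at h1 h2
  rw [star_zero] at h2
  rw [sub_mul, mul_sub, mul_sub, mul_add, mul_add, h1, h2, starProjection_mul_projectionL,
    starProjection_right_mul_projectionL]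
  simp only [mul_one]
  abel

/-- Both factors are self-adjoint, so this is the adjoint of the opposite product. -/
theorem Submodule.mul_starProjection_sub (h : E.IsTopCompl F) :
    (E.projectionL F h + star (E.projectionL F h) - 1) *
      (E.starProjection - F.starProjection) = 1 := by
  have h1 := congrArg star (starProjection_sub_mul h)
  simpa [star_mul, star_starProjection, add_comm] using h1

theorem Submodule.isUnit_starProjection_sub (h : E.IsTopCompl F) :
    IsUnit (E.starProjection - F.starProjection) :=
  ⟨⟨_, _, starProjection_sub_mul h, mul_starProjection_sub h⟩, rfl⟩

theorem Submodule.isUnit_projectionL_add_star (h : E.IsTopCompl F) :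
    IsUnit (E.projectionL F h + star (E.projectionL F h) - 1) :=
  ⟨⟨_, _, mul_starProjection_sub h, starProjection_sub_mul h⟩, rfl⟩

/-- The projection onto `E` along `F`, in terms of the orthogonal projections. -/
theorem Submodule.projectionL_eq_mul_inverse (h : E.IsTopCompl F) :
    E.projectionL F h =
      E.starProjection * Ring.inverse (E.starProjection - F.starProjection) := by
  rw [Ring.eq_mul_inverse_iff_mul_eq _ _ _ (isUnit_starProjection_sub h), mul_sub,
    projectionL_mul_starProjection, projectionL_mul_starProjection_right, sub_zero]

/-- The orthogonal projection onto `E`, in terms of the projection onto `E` along `F`. -/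
theorem Submodule.starProjection_eq_mul_inverse (h : E.IsTopCompl F) :
    E.starProjection = E.projectionL F h *
      Ring.inverse (E.projectionL F h + star (E.projectionL F h) - 1) := by
  have h1 := congrArg star (projectionL_mul_starProjection h)
  rw [star_mul, star_starProjection] at h1
  rw [Ring.eq_mul_inverse_iff_mul_eq _ _ _ (isUnit_projectionL_add_star h), mul_sub, mul_add, h1,
    starProjection_mul_projectionL, mul_one, add_sub_cancel_right]

/-- Two closed subspaces of a Hilbert space are complementary if and only if the difference of the
orthogonal projections is invertible. -/
theorem Submodule.isTopCompl_iff_isUnit_starProjection_sub (hE : IsClosed (E : Set H))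
    (hF : IsClosed (F : Set H)) :
    E.IsTopCompl F ↔ IsUnit (E.starProjection - F.starProjection) := by
  refine ⟨isUnit_starProjection_sub, fun hu => ?_⟩
  refine isTopCompl_iff_isCompl_isClosed.2 ⟨⟨?_, ?_⟩, hE, hF⟩
  -- A vector common to `E` and `F` is fixed by both projections, hence killed by their invertible
  -- difference.
  · rw [Submodule.disjoint_def]
    intro x hxE hxF
    have h0 : (E.starProjection - F.starProjection) x = 0 := by
      rw [sub_apply, starProjection_eq_self_iff.2 hxE,
        starProjection_eq_self_iff.2 hxF, sub_self]
    have h1 := DFunLike.congr_fun (Ring.inverse_mul_cancel _ hu) x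
    rw [mul_apply_eq_comp, h0, map_zero] at h1
    exact h1.symm
  -- Surjectivity of the difference writes every vector as $P_Ey-P_Fy$.
  · rw [codisjoint_iff_le_sup]
    intro x _
    have h1 := DFunLike.congr_fun (Ring.mul_inverse_cancel _ hu) x
    rw [mul_apply_eq_comp, sub_apply] at h1
    have h2 : x = _ := h1.symm
    rw [h2, sub_eq_add_neg]
    exact Submodule.add_mem_sup (E.starProjection_apply_mem _)
      (F.neg_mem (F.starProjection_apply_mem _))

end Projections

/-! ### Real analyticity of the orthogonal projection onto the range -/

section RealAnalytic

variable {H : Type u} [NormedAddCommGroup H] [InnerProductSpace ℂ H] [CompleteSpace H]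

/-- The adjoint is conjugate linear, so it is analytic over the reals only. All losses of complex
analyticity come from here. -/
theorem analyticAt_star (A : H →L[ℂ] H) : AnalyticAt ℝ (star : (H →L[ℂ] H) → (H →L[ℂ] H)) A :=
  (starL' ℝ : (H →L[ℂ] H) ≃L[ℝ] (H →L[ℂ] H)).analyticAt A

/-- The formula that recovers the orthogonal projection from an idempotent with the same range. -/
noncomputable def orthogonalize (Q : H →L[ℂ] H) : H →L[ℂ] H := Q * Ring.inverse (Q + star Q - 1)

theorem analyticOnNhd_orthogonalize :
    AnalyticOnNhd ℝ orthogonalize {Q : H →L[ℂ] H | IsUnit (Q + star Q - 1)} := by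
  intro Q hQ
  have h1 : AnalyticAt ℝ (fun Q : H →L[ℂ] H => Q + star Q - 1) Q :=
    (analyticAt_id.add (analyticAt_star Q)).sub analyticAt_const
  exact analyticAt_id.mul (h1.ringInverse hQ)

end RealAnalytic

/-! ### The Grassmann manifold embedded by orthogonal projections -/

namespace Grassmannian

variable {H : Type u} [NormedAddCommGroup H] [InnerProductSpace ℂ H]

/-- If $x=(e+Se)+f$ with $e\in E$ and $f\in F$, then $e$ is the component of $x$ in $E$ along $F$.
The oblique projection onto the graph is thus affine in `S`. -/
theorem projectionL_graph {E F : Grassmannian ℂ H} (h : E.space.IsTopCompl F.space)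
    (S : E.space →L[ℂ] F.space) :
    (graph h S).space.projectionL F.space (isTopCompl_graph h S) =
      graphMap E F S ∘L E.space.projectionOntoL F.space h := by
  have hS : (graph h S).space.IsTopCompl F.space := isTopCompl_graph h S
  ext x
  have hx := Submodule.projectionL_add_projectionL_eq_self hS x
  obtain ⟨e, he⟩ : (graph h S).space.projectionL F.space hS x ∈ (graph h S).space :=
    Submodule.projectionL_apply_mem hS x
  have he' : graphMap E F S e = (graph h S).space.projectionL F.space hS x := he
  obtain ⟨f, hf⟩ : ∃ f : F.space, (f : H) = F.space.projectionL (graph h S).space hS.symm x :=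
    ⟨⟨_, Submodule.projectionL_apply_mem hS.symm x⟩, rfl⟩
  have h1 : E.space.projectionOntoL F.space h x = e := by
    rw [← hx, ← he', ← hf]
    simp [graphMap]
  rw [ContinuousLinearMap.comp_apply, h1, he']

theorem continuous_graph {E F : Grassmannian ℂ H} (h : E.space.IsTopCompl F.space) :
    Continuous (graph h) := by
  rw [continuous_iff_coinduced_le]
  exact le_iSup_of_le E (le_iSup_of_le F (le_iSup_of_le h le_rfl))

variable [CompleteSpace H]

/-- The orthogonal projection onto an element of the Grassmannian. -/
noncomputable def proj (G : Grassmannian ℂ H) : H →L[ℂ] H := G.space.starProjection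

theorem proj_graph {E F : Grassmannian ℂ H} (h : E.space.IsTopCompl F.space)
    (S : E.space →L[ℂ] F.space) :
    proj (graph h S) =
      orthogonalize (graphMap E F S ∘L E.space.projectionOntoL F.space h) := by
  rw [← projectionL_graph]
  exact Submodule.starProjection_eq_mul_inverse _

/-- An inverse chart followed by `proj` is a continuous affine map followed by `orthogonalize`. -/
theorem analyticOnNhd_proj_graph {E F : Grassmannian ℂ H} (h : E.space.IsTopCompl F.space) :
    AnalyticOnNhd ℝ (proj ∘ graph h) univ := by
  have h1 : AnalyticOnNhd ℂ (fun S => graphMap E F S ∘L E.space.projectionOntoL F.space h)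
      univ := by
    have : (fun S => graphMap E F S ∘L E.space.projectionOntoL F.space h) = fun S =>
        E.space.subtypeL ∘L E.space.projectionOntoL F.space h +
          ((ContinuousLinearMap.compL ℂ H F.space H F.space.subtypeL) ∘L
            (ContinuousLinearMap.compL ℂ H E.space F.space).flip
              (E.space.projectionOntoL F.space h)) S := by
      ext S x
      simp [graphMap]
    rw [this]
    exact fun S _ => analyticAt_const.add (ContinuousLinearMap.analyticAt _ _)
  have h2 : AnalyticOnNhd ℝ (fun S => graphMap E F S ∘L E.space.projectionOntoL F.space h)
      univ := fun S hS => (h1 S hS).restrictScalars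
  have h3 : proj ∘ graph h = orthogonalize ∘
      fun S => graphMap E F S ∘L E.space.projectionOntoL F.space h := funext (proj_graph h)
  rw [h3]
  refine analyticOnNhd_orthogonalize.comp h2 fun S _ => ?_
  rw [mem_ofPred_eq, ← projectionL_graph]
  exact Submodule.isUnit_projectionL_add_star _

theorem isTopCompl_iff {G F : Grassmannian ℂ H} :
    G.space.IsTopCompl F.space ↔ IsUnit (proj G - proj F) :=
  Submodule.isTopCompl_iff_isUnit_starProjection_sub G.isClosed F.isClosed

/-- For $x\in E$, the component of $x$ in $G$ along $F$ is $x+Tx$, where $T$ is the slope, and its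
component in $F$ along $E$ is $Tx$. This expresses the chart through `proj G` alone, with `E` and
`F` fixed. -/
theorem slope_eq {E F G : Grassmannian ℂ H} (h : E.space.IsTopCompl F.space)
    (hG : G.space.IsTopCompl F.space) :
    slope E F G = F.space.projectionOntoL E.space h.symm ∘L
      (proj G * Ring.inverse (proj G - proj F)) ∘L E.space.subtypeL := by
  have h1 : proj G * Ring.inverse (proj G - proj F) = G.space.projectionL F.space hG :=
    (Submodule.projectionL_eq_mul_inverse hG).symm
  rw [h1]
  ext x
  have hx := Submodule.projectionL_add_projectionL_eq_self hG (x : H)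
  have h2 := congrArg (F.space.projectionOntoL E.space h.symm) hx
  have h3 : F.space.projectionOntoL E.space h.symm
      (F.space.projectionL G.space hG.symm (x : H)) =
      F.space.projectionOntoL G.space hG.symm (x : H) := by
    rw [← Submodule.coe_projectionOntoL_apply, Submodule.projectionOntoL_apply_left]
  rw [map_add, h3, Submodule.projectionOntoL_apply_right] at h2
  simp only [slope, hG, dite_true, neg_apply, ContinuousLinearMap.comp_apply,
    Submodule.subtypeL_apply]
  rw [eq_neg_of_add_eq_zero_left h2, Submodule.coe_neg]

/-- The topology is coinduced by the inverse charts, so continuity needs checking only after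
composition with each `graph h`. -/
theorem continuous_proj : Continuous (proj : Grassmannian ℂ H → H →L[ℂ] H) := by
  refine continuous_iSup_dom.2 fun E => continuous_iSup_dom.2 fun F =>
    continuous_iSup_dom.2 fun h => continuous_coinduced_dom.2 ?_
  exact continuousOn_univ.1 (analyticOnNhd_proj_graph h).continuousOn

theorem proj_injective : Function.Injective (proj : Grassmannian ℂ H → H →L[ℂ] H) :=
  fun E F h => Subtype.ext (Submodule.starProjection_inj (U := E.space) (V := F.space).1 h)

instance : T2Space (Grassmannian ℂ H) :=
  T2Space.of_injective_continuous proj_injective continuous_proj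

/-- Every element of the Grassmannian has a complement in it: the orthogonal complement. -/
theorem exists_isTopCompl (G : Grassmannian ℂ H) :
    ∃ F : Grassmannian ℂ H, G.space.IsTopCompl F.space := by
  have h := Submodule.isTopCompl_orthogonal (K := G.space)
  refine ⟨⟨G.spaceᗮ, h.symm.closedComplemented, fun h0 => G.2.2.2 ?_, fun h0 => G.2.2.1 ?_⟩, h⟩
  · exact (Submodule.orthogonal_eq_bot_iff (K := G.space)).1 h0
  · exact (Submodule.orthogonal_eq_top_iff (K := G.space)).1 h0

/-- The atlas of the Grassmann manifold, seen as a real manifold, is induced by the embedding that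
sends a subspace to the orthogonal projection onto it. -/
theorem isEmbeddedAtlas_proj :
    IsEmbeddedAtlas (proj : Grassmannian ℂ H → H →L[ℂ] H)
      (BanachChart.toReal '' atlas ℂ H) where
  continuous := continuous_proj
  cover G := by
    obtain ⟨F, h⟩ := exists_isTopCompl G
    exact ⟨_, mem_image_of_mem _ ⟨G, F, h, rfl⟩, h⟩
  isOpen_target := by
    rintro _ ⟨_, ⟨E, F, h, rfl⟩, rfl⟩
    exact isOpen_univ
  continuousOn_symm := by
    rintro _ ⟨_, ⟨E, F, h, rfl⟩, rfl⟩
    exact (continuous_graph h).continuousOn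
  analytic_symm := by
    rintro _ ⟨_, ⟨E, F, h, rfl⟩, rfl⟩
    exact analyticOnNhd_proj_graph h
  extend := by
    rintro _ ⟨_, ⟨E, F, h, rfl⟩, rfl⟩
    have hΨ : AnalyticOnNhd ℝ (fun X : H →L[ℂ] H =>
        F.space.projectionOntoL E.space h.symm ∘L
          (X * Ring.inverse (X - proj F)) ∘L E.space.subtypeL)
        {X | IsUnit (X - proj F)} := by
      intro X hX
      have h1 : AnalyticAt ℂ (fun X : H →L[ℂ] H => X * Ring.inverse (X - proj F)) X :=
        analyticAt_id.mul ((analyticAt_id.sub analyticAt_const).ringInverse hX)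
      have h2 := ((ContinuousLinearMap.compL ℂ E.space H F.space
        (F.space.projectionOntoL E.space h.symm) ∘L
          (ContinuousLinearMap.compL ℂ E.space H H).flip E.space.subtypeL).analyticAt _).fun_comp
            h1
      exact h2.restrictScalars
    -- Being a complement of `F` is the open condition that `proj G - proj F` is invertible, so the
    -- chart domain is cut out by an open set of operators.
    refine ⟨{X | IsUnit (X - proj F)}, _, ?_, hΨ, ?_, fun G hG => ?_⟩
    · exact Units.isOpen.preimage (by fun_prop : Continuous fun X : H →L[ℂ] H => X - proj F)
    · ext G
      exact isTopCompl_iff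
    · exact slope_eq h (isTopCompl_iff.2 hG)

end Grassmannian

/-! ### The fibers as Banach spaces and conjugation between them -/

section Fibers

variable {H : Type u} [NormedAddCommGroup H] [InnerProductSpace ℂ H] [CompleteSpace H]

open Grassmannian

theorem isIdempotentElem_proj (E : Grassmannian ℂ H) : IsIdempotentElem (proj E) :=
  Submodule.isIdempotentElem_starProjection E.space

/-- An idempotent is the projection onto its range along its kernel, so the formula for oblique
projections applies with `F` the kernel. -/
theorem proj_rangeMap (Q : idempotents ℂ H) : proj (rangeMap Q) = orthogonalize Q.1 := by
  have hQ : IsIdempotentElem Q.1 := Q.2.2.2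
  have h : (rangeMap Q).space.IsTopCompl Q.1.ker := ContinuousLinearMap.IsIdempotentElem.isTopCompl hQ
  have : CompleteSpace Q.1.ker := h.isClosed'.completeSpace_coe
  have h1 := Submodule.starProjection_eq_mul_inverse h
  have h2 : (rangeMap Q).space.projectionL Q.1.ker h = Q.1 :=
    (ContinuousLinearMap.IsIdempotentElem.eq_projectionL hQ).symm
  rwa [h2] at h1

theorem isUnit_add_star_sub_one (Q : idempotents ℂ H) : IsUnit (Q.1 + star Q.1 - 1) := by
  have hQ : IsIdempotentElem Q.1 := Q.2.2.2
  have h : (rangeMap Q).space.IsTopCompl Q.1.ker := ContinuousLinearMap.IsIdempotentElem.isTopCompl hQ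
  have : CompleteSpace Q.1.ker := h.isClosed'.completeSpace_coe
  have h1 := Submodule.isUnit_projectionL_add_star h
  have h2 : (rangeMap Q).space.projectionL Q.1.ker h = Q.1 :=
    (ContinuousLinearMap.IsIdempotentElem.eq_projectionL hQ).symm
  rwa [h2] at h1

theorem Fiber.proj_mul {E : Grassmannian ℂ H} (x : Fiber (rangeMap (𝕜 := ℂ) (X := H)) E) :
    proj E * x.val.1 = x.val.1 := by
  obtain ⟨Q, rfl⟩ := x
  exact Submodule.starProjection_mul_of_forall_mem fun y => ⟨y, rfl⟩

theorem Fiber.mul_proj {E : Grassmannian ℂ H} (x : Fiber (rangeMap (𝕜 := ℂ) (X := H)) E) :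
    x.val.1 * proj E = proj E := by
  obtain ⟨Q, rfl⟩ := x
  refine (Submodule.mul_starProjection_of_forall_mem (B := 1) ?_).trans (one_mul _)
  rintro _ ⟨y, rfl⟩
  exact DFunLike.congr_fun Q.2.2.2 y

/-- An operator `Q` is an idempotent with range `E` if `P Q = Q` and `Q P = P` for the orthogonal
projection `P` onto `E`. -/
def Fiber.ofMul {E : Grassmannian ℂ H} {Q : H →L[ℂ] H} (h₁ : proj E * Q = Q)
    (h₂ : Q * proj E = proj E) : Fiber (rangeMap (𝕜 := ℂ) (X := H)) E :=
  have hr : ∀ x, x ∈ E.space ↔ proj E x = x := fun _ => Submodule.starProjection_eq_self_iff.symm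
  have hE : Q.range = E.space := by
    ext x
    refine ⟨?_, fun hx => ⟨x, ?_⟩⟩
    · rintro ⟨y, rfl⟩
      exact (hr _).2 (DFunLike.congr_fun h₁ y)
    · have h3 := DFunLike.congr_fun h₂ x
      rwa [mul_apply_eq_comp, (hr x).1 hx] at h3
  ⟨⟨Q,
    fun h0 => E.2.2.1 (hE.symm.trans (by rw [h0]; exact LinearMap.range_zero)),
    fun h1 => E.2.2.2 (hE.symm.trans (by rw [h1]; exact LinearMap.range_id)),
    by
      change Q * Q = Q
      calc Q * Q = Q * (proj E * Q) := by rw [h₁]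
        _ = Q := by rw [← mul_assoc, h₂, h₁]⟩, Subtype.ext hE⟩

/-- The direction of the affine space of all idempotents with range `E`. -/
def fiberDirection (E : Grassmannian ℂ H) : Submodule ℂ (H →L[ℂ] H) where
  carrier := {S | proj E * S = S ∧ S * proj E = 0}
  add_mem' {S S'} h h' := by
    refine ⟨?_, ?_⟩
    · rw [mul_add, h.1, h'.1]
    · rw [add_mul, h.2, h'.2, add_zero]
  zero_mem' := ⟨mul_zero _, zero_mul _⟩
  smul_mem' c S h := by
    refine ⟨?_, ?_⟩
    · rw [mul_smul_comm, h.1]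
    · rw [smul_mul_assoc, h.2, smul_zero]

theorem isClosed_fiberDirection (E : Grassmannian ℂ H) :
    IsClosed (fiberDirection E : Set (H →L[ℂ] H)) :=
  (isClosed_eq (by fun_prop : Continuous fun S : H →L[ℂ] H => proj E * S) continuous_id).inter
    (isClosed_eq (by fun_prop : Continuous fun S : H →L[ℂ] H => S * proj E) continuous_const)

instance (E : Grassmannian ℂ H) : CompleteSpace (fiberDirection E) :=
  (isClosed_fiberDirection E).completeSpace_coe

/-- The bijection from a fiber to its direction that sends the orthogonal projection to zero. -/
noncomputable def fiberEquiv (E : Grassmannian ℂ H) :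
    Fiber (rangeMap (𝕜 := ℂ) (X := H)) E ≃ fiberDirection E where
  toFun x := ⟨x.val.1 - proj E, by
    refine ⟨?_, ?_⟩
    · rw [mul_sub, x.proj_mul, (isIdempotentElem_proj E).eq]
    · rw [sub_mul, x.mul_proj, (isIdempotentElem_proj E).eq, sub_self]⟩
  invFun S := Fiber.ofMul (Q := proj E + S.1)
    (by rw [mul_add, (isIdempotentElem_proj E).eq, S.2.1])
    (by rw [add_mul, (isIdempotentElem_proj E).eq, S.2.2, add_zero])
  left_inv x := Subtype.ext (Subtype.ext (add_sub_cancel _ _))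
  right_inv S := Subtype.ext (add_sub_cancel_left _ _)

/-- The additive group structure of a fiber; the zero element is the orthogonal projection. -/
@[reducible]
noncomputable def fiberAddCommGroup (E : Grassmannian ℂ H) :
    AddCommGroup (Fiber (rangeMap (𝕜 := ℂ) (X := H)) E) := (fiberEquiv E).addCommGroup

attribute [local instance] fiberAddCommGroup

/-- The complex vector space structure of a fiber. -/
@[reducible]
noncomputable def fiberModule (E : Grassmannian ℂ H) :
    Module ℂ (Fiber (rangeMap (𝕜 := ℂ) (X := H)) E) := (fiberEquiv E).module ℂ

attribute [local instance] fiberModule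

/-- The bijection `fiberEquiv` as a linear map. -/
noncomputable def fiberLinearEquiv (E : Grassmannian ℂ H) :
    Fiber (rangeMap (𝕜 := ℂ) (X := H)) E ≃ₗ[ℂ] fiberDirection E := (fiberEquiv E).linearEquiv ℂ

/-- The norm of a fiber: the distance to the orthogonal projection. -/
@[reducible]
noncomputable def fiberNormedAddCommGroup (E : Grassmannian ℂ H) :
    NormedAddCommGroup (Fiber (rangeMap (𝕜 := ℂ) (X := H)) E) :=
  NormedAddCommGroup.induced _ _ (fiberLinearEquiv E) (fiberLinearEquiv E).injective

attribute [local instance] fiberNormedAddCommGroup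

/-- The complex normed space structure of a fiber. -/
@[reducible]
noncomputable def fiberNormedSpace (E : Grassmannian ℂ H) :
    NormedSpace ℂ (Fiber (rangeMap (𝕜 := ℂ) (X := H)) E) :=
  NormedSpace.induced ℂ _ _ (fiberLinearEquiv E)

attribute [local instance] fiberNormedSpace

/-- The bijection `fiberEquiv` as a linear isometry. -/
noncomputable def fiberIsometry (E : Grassmannian ℂ H) :
    Fiber (rangeMap (𝕜 := ℂ) (X := H)) E ≃ₗᵢ[ℂ] fiberDirection E where
  toLinearEquiv := fiberLinearEquiv E
  norm_map' _ := rfl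

theorem completeSpace_fiber (E : Grassmannian ℂ H) :
    CompleteSpace (Fiber (rangeMap (𝕜 := ℂ) (X := H)) E) :=
  (fiberIsometry E).toIsometryEquiv.completeSpace

attribute [local instance] completeSpace_fiber

/-- The linear part of the inclusion of a fiber into the space of operators. -/
noncomputable def fiberIncl (E : Grassmannian ℂ H) :
    Fiber (rangeMap (𝕜 := ℂ) (X := H)) E →ₗᵢ[ℂ] (H →L[ℂ] H) :=
  (fiberDirection E).subtypeₗᵢ.comp (fiberIsometry E).toLinearIsometry

theorem fiberIncl_mem {E : Grassmannian ℂ H} (x : Fiber (rangeMap (𝕜 := ℂ) (X := H)) E) :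
    fiberIncl E x ∈ fiberDirection E := (fiberIsometry E x).2

theorem Fiber.val_eq {E : Grassmannian ℂ H} (x : Fiber (rangeMap (𝕜 := ℂ) (X := H)) E) :
    x.val.1 = proj E + fiberIncl E x := (add_sub_cancel _ _).symm

/-- The inclusion of a fiber into the space of operators, as an affine isometry. -/
noncomputable def fiberAffineIsometry (E : Grassmannian ℂ H) :
    Fiber (rangeMap (𝕜 := ℂ) (X := H)) E →ᵃⁱ[ℂ] (H →L[ℂ] H) :=
  (AffineIsometryEquiv.constVAdd ℂ (H →L[ℂ] H) (proj E)).toAffineIsometry.comp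
    (fiberIncl E).toAffineIsometry

theorem fiberAffineIsometry_apply {E : Grassmannian ℂ H}
    (x : Fiber (rangeMap (𝕜 := ℂ) (X := H)) E) : fiberAffineIsometry E x = x.val.1 :=
  x.val_eq.symm

/-- Composed with the inclusion of the idempotents into the operators, the map is an affine
isometry. -/
theorem Fiber.isInducing_val (E : Grassmannian ℂ H) :
    IsInducing (Fiber.val : Fiber (rangeMap (𝕜 := ℂ) (X := H)) E → idempotents ℂ H) := by
  rw [← IsInducing.subtypeVal.of_comp_iff]
  have h : Subtype.val ∘ (Fiber.val : Fiber (rangeMap (𝕜 := ℂ) (X := H)) E → idempotents ℂ H) =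
      fiberAffineIsometry E := funext fun x => (fiberAffineIsometry_apply x).symm
  rw [h]
  exact (fiberAffineIsometry E).isometry.isUniformInducing.isInducing

theorem mulLeftRight_mem_fiberDirection (E : Grassmannian ℂ H) (X : H →L[ℂ] H) :
    ContinuousLinearMap.mulLeftRight ℂ (H →L[ℂ] H) (proj E) (1 - proj E) X ∈
      fiberDirection E := by
  refine ⟨?_, ?_⟩
  · rw [ContinuousLinearMap.mulLeftRight_apply, ← mul_assoc, ← mul_assoc,
      (isIdempotentElem_proj E).eq]
  · rw [ContinuousLinearMap.mulLeftRight_apply, mul_assoc,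
      (isIdempotentElem_proj E).one_sub_mul_self, mul_zero]

/-- The projection of the space of operators onto the direction of a fiber. -/
noncomputable def toFiber (E : Grassmannian ℂ H) :
    (H →L[ℂ] H) →L[ℂ] Fiber (rangeMap (𝕜 := ℂ) (X := H)) E :=
  (fiberIsometry E).symm.toContinuousLinearEquiv.toContinuousLinearMap ∘L
    (ContinuousLinearMap.mulLeftRight ℂ (H →L[ℂ] H) (proj E) (1 - proj E)).codRestrict
      (fiberDirection E) (mulLeftRight_mem_fiberDirection E)

theorem fiberIncl_toFiber (E : Grassmannian ℂ H) (X : H →L[ℂ] H) :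
    fiberIncl E (toFiber E X) = proj E * X * (1 - proj E) :=
  congrArg Subtype.val ((fiberIsometry E).apply_symm_apply
    ⟨_, mulLeftRight_mem_fiberDirection E X⟩)

/-- The map `S ↦ A S B` between the directions of two fibers. -/
noncomputable def fiberConj (E F : Grassmannian ℂ H) (A B : H →L[ℂ] H) :
    Fiber (rangeMap (𝕜 := ℂ) (X := H)) E →L[ℂ] Fiber (rangeMap (𝕜 := ℂ) (X := H)) F :=
  toFiber F ∘L ContinuousLinearMap.mulLeftRight ℂ (H →L[ℂ] H) A B ∘L
    (fiberIncl E).toContinuousLinearMap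

theorem fiberConj_apply (E F : Grassmannian ℂ H) (A B : H →L[ℂ] H)
    (x : Fiber (rangeMap (𝕜 := ℂ) (X := H)) E) :
    fiberConj E F A B x = toFiber F (A * fiberIncl E x * B) := rfl

/-- The compression in `toFiber` makes `fiberConj` defined for arbitrary `A` and `B`. Under the
intertwining relations it changes nothing: $P_FASB=AP_ESB=ASB$ and $ASBP_F=ASP_EB=0$. -/
theorem fiberIncl_fiberConj {E F : Grassmannian ℂ H} {A B : H →L[ℂ] H}
    (hA : proj F * A = A * proj E) (hB : B * proj F = proj E * B)
    (x : Fiber (rangeMap (𝕜 := ℂ) (X := H)) E) :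
    fiberIncl F (fiberConj E F A B x) = A * fiberIncl E x * B := by
  obtain ⟨h1, h2⟩ := fiberIncl_mem x
  rw [fiberConj_apply, fiberIncl_toFiber]
  rw [← mul_assoc, ← mul_assoc, hA, mul_assoc A, h1, mul_sub, mul_one, mul_assoc _ B, hB,
    ← mul_assoc, mul_assoc A _ (proj E), h2, mul_zero, zero_mul, sub_zero]

/-- Only the inner pair has to intertwine, since the final compression onto the direction over `G`
is the same on both sides. -/
theorem fiberConj_fiberConj {E F G : Grassmannian ℂ H} {A B A' B' : H →L[ℂ] H}
    (hA : proj F * A = A * proj E) (hB : B * proj F = proj E * B)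
    (x : Fiber (rangeMap (𝕜 := ℂ) (X := H)) E) :
    fiberConj F G A' B' (fiberConj E F A B x) = fiberConj E G (A' * A) (B * B') x := by
  rw [fiberConj_apply, fiberIncl_fiberConj hA hB, fiberConj_apply]
  simp only [mul_assoc]

theorem fiberConj_one (E : Grassmannian ℂ H) (x : Fiber (rangeMap (𝕜 := ℂ) (X := H)) E) :
    fiberConj E E 1 1 x = x := by
  apply (fiberIncl E).injective
  rw [fiberIncl_fiberConj (by simp) (by simp), one_mul, mul_one]

/-- Since $AP_EB=P_FAB=P_F$, conjugation of the idempotents themselves respects the zero elements of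
the fibers, so it agrees with the linear map on directions. -/
theorem Fiber.val_fiberConj {E F : Grassmannian ℂ H} {A B : H →L[ℂ] H} (hAB : A * B = 1)
    (hA : proj F * A = A * proj E) (hB : B * proj F = proj E * B)
    (x : Fiber (rangeMap (𝕜 := ℂ) (X := H)) E) :
    (fiberConj E F A B x).val.1 = A * (proj E + fiberIncl E x) * B := by
  rw [Fiber.val_eq, fiberIncl_fiberConj hA hB, mul_add, add_mul, ← hA, mul_assoc (proj F), hAB,
    mul_one]

/-- The dependence on the pair of operators is bounded bilinear for the operator norm on the target.
This yields norm analyticity of the transition maps, not merely pointwise analyticity. -/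
theorem analyticOnNhd_fiberConj (E F : Grassmannian ℂ H) :
    AnalyticOnNhd ℝ (fun p : (H →L[ℂ] H) × (H →L[ℂ] H) => fiberConj E F p.1 p.2) univ := by
  intro p _
  have h1 : AnalyticAt ℂ (fun p : (H →L[ℂ] H) × (H →L[ℂ] H) =>
      ContinuousLinearMap.mulLeftRight ℂ (H →L[ℂ] H) p.1 p.2) p :=
    (ContinuousLinearMap.mulLeftRight ℂ (H →L[ℂ] H)).analyticAt_bilinear p
  have h2 := ((ContinuousLinearMap.compL ℂ (Fiber (rangeMap (𝕜 := ℂ) (X := H)) E) (H →L[ℂ] H)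
    (Fiber (rangeMap (𝕜 := ℂ) (X := H)) F) (toFiber F) ∘L
      (ContinuousLinearMap.compL ℂ (Fiber (rangeMap (𝕜 := ℂ) (X := H)) E) (H →L[ℂ] H)
        (H →L[ℂ] H)).flip (fiberIncl E).toContinuousLinearMap).analyticAt _).fun_comp h1
  exact h2.restrictScalars

end Fibers

theorem Fiber.map_val {T B : Type u} {κ : T → B} {ω : B} (x : Fiber κ ω) : κ x.val = ω := x.2

/-! ### Local trivializations and transition maps -/

section Trivialization

variable {H : Type u} [NormedAddCommGroup H] [InnerProductSpace ℂ H] [CompleteSpace H]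

open Grassmannian

attribute [local instance] fiberAddCommGroup fiberModule fiberNormedAddCommGroup fiberNormedSpace
  completeSpace_fiber

/-- For the orthogonal projection `P` onto `E` and another orthogonal projection `X`, this operator
maps the range of `P` to the range of `X` and the kernel of `P` to the kernel of `X`. -/
noncomputable def frame (E : Grassmannian ℂ H) (X : H →L[ℂ] H) : H →L[ℂ] H :=
  X * proj E + (1 - X) * (1 - proj E)

theorem analyticAt_frame (E : Grassmannian ℂ H) (X : H →L[ℂ] H) : AnalyticAt ℝ (frame E) X := by
  have h : AnalyticAt ℂ (frame E) X := by unfold frame; fun_prop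
  exact h.restrictScalars

/-- Both sides equal $P_FP_E$. -/
theorem proj_mul_frame (E F : Grassmannian ℂ H) :
    proj F * frame E (proj F) = frame E (proj F) * proj E := by
  have h1 := (isIdempotentElem_proj E).eq
  have h2 := (isIdempotentElem_proj F).eq
  rw [frame, mul_add, add_mul, ← mul_assoc (proj F), h2, ← mul_assoc (proj F) (1 - proj F),
    (isIdempotentElem_proj F).mul_one_sub_self, zero_mul, mul_assoc _ (proj E) (proj E), h1,
    mul_assoc _ (1 - proj E), (isIdempotentElem_proj E).one_sub_mul_self, mul_zero]

/-- The neighborhood of `E` over which the bundle of idempotents is trivialized. -/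
def trivSet (E : Grassmannian ℂ H) : Set (Grassmannian ℂ H) := {F | IsUnit (frame E (proj F))}

theorem isOpen_trivSet (E : Grassmannian ℂ H) : IsOpen (trivSet E) :=
  Units.isOpen.preimage (f := fun F => frame E (proj F)) <| by
    have : Continuous (frame E) := by unfold frame; fun_prop
    exact this.comp continuous_proj

theorem mem_trivSet_self (E : Grassmannian ℂ H) : E ∈ trivSet E := by
  have h : frame E (proj E) = 1 := by
    rw [frame, (isIdempotentElem_proj E).eq, (isIdempotentElem_proj E).one_sub.eq,
      add_sub_cancel]
  change IsUnit _
  rw [h]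
  exact isUnit_one

/-- The inverse of `frame`. -/
noncomputable def coframe (E : Grassmannian ℂ H) (X : H →L[ℂ] H) : H →L[ℂ] H :=
  Ring.inverse (frame E X)

theorem analyticAt_coframe (E : Grassmannian ℂ H) {X : H →L[ℂ] H} (hX : IsUnit (frame E X)) :
    AnalyticAt ℝ (coframe E) X :=
  (analyticAt_frame E X).ringInverse hX

section

variable {E F : Grassmannian ℂ H} (hF : F ∈ trivSet E)
include hF

theorem frame_mul_coframe : frame E (proj F) * coframe E (proj F) = 1 :=
  Ring.mul_inverse_cancel _ hF

theorem coframe_mul_frame : coframe E (proj F) * frame E (proj F) = 1 :=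
  Ring.inverse_mul_cancel _ hF

theorem coframe_mul_proj :
    coframe E (proj F) * proj F = proj E * coframe E (proj F) := by
  calc _ = coframe E (proj F) * (proj F * frame E (proj F)) * coframe E (proj F) := by
        rw [mul_assoc, mul_assoc, frame_mul_coframe hF, mul_one]
    _ = _ := by rw [proj_mul_frame, ← mul_assoc, coframe_mul_frame hF, one_mul]

end

/-- The isomorphism between the fibers over `E` and over `F ∈ trivSet E`. -/
noncomputable def fiberMap (E F : Grassmannian ℂ H) :
    Fiber (rangeMap (𝕜 := ℂ) (X := H)) E →L[ℂ] Fiber (rangeMap (𝕜 := ℂ) (X := H)) F :=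
  fiberConj E F (frame E (proj F)) (coframe E (proj F))

/-- The inverse of `fiberMap`. -/
noncomputable def fiberMapInv (E F : Grassmannian ℂ H) :
    Fiber (rangeMap (𝕜 := ℂ) (X := H)) F →L[ℂ] Fiber (rangeMap (𝕜 := ℂ) (X := H)) E :=
  fiberConj F E (coframe E (proj F)) (frame E (proj F))

theorem fiberMapInv_fiberMap {E F : Grassmannian ℂ H} (hF : F ∈ trivSet E)
    (x : Fiber (rangeMap (𝕜 := ℂ) (X := H)) E) : fiberMapInv E F (fiberMap E F x) = x := by
  rw [fiberMapInv, fiberMap, fiberConj_fiberConj (proj_mul_frame E F) (coframe_mul_proj hF),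
    coframe_mul_frame hF, fiberConj_one]

theorem fiberMap_fiberMapInv {E F : Grassmannian ℂ H} (hF : F ∈ trivSet E)
    (x : Fiber (rangeMap (𝕜 := ℂ) (X := H)) F) : fiberMap E F (fiberMapInv E F x) = x := by
  rw [fiberMapInv, fiberMap, fiberConj_fiberConj (coframe_mul_proj hF).symm
    (proj_mul_frame E F).symm, frame_mul_coframe hF, fiberConj_one]

/-- The fiber coordinate of an idempotent in the trivialization at `E`. -/
noncomputable def fiberCoord (E : Grassmannian ℂ H) (Q : idempotents ℂ H) :
    Fiber (rangeMap (𝕜 := ℂ) (X := H)) E :=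
  fiberMapInv E (rangeMap Q) ⟨Q, rfl⟩

/-- The base point `rangeMap y.val` equals `F` only propositionally; eliminating that equality once
here avoids transport between fibers later. -/
theorem fiberCoord_val (E : Grassmannian ℂ H) {F : Grassmannian ℂ H}
    (y : Fiber (rangeMap (𝕜 := ℂ) (X := H)) F) : fiberCoord E y.val = fiberMapInv E F y := by
  obtain ⟨Q, rfl⟩ := y
  rfl

/-- The trivialization of the bundle of idempotents over `trivSet E`. -/
noncomputable def triv (E : Grassmannian ℂ H) :
    PartialEquiv (Grassmannian ℂ H × Fiber (rangeMap (𝕜 := ℂ) (X := H)) E) (idempotents ℂ H) where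
  toFun p := (fiberMap E p.1 p.2).val
  invFun Q := (rangeMap Q, fiberCoord E Q)
  source := trivSet E ×ˢ univ
  target := rangeMap ⁻¹' trivSet E
  map_source' p hp := by
    rw [mem_preimage, (fiberMap E p.1 p.2).map_val]
    exact hp.1
  map_target' Q hQ := ⟨hQ, mem_univ _⟩
  left_inv' p hp := by
    rw [(fiberMap E p.1 p.2).map_val, fiberCoord_val, fiberMapInv_fiberMap hp.1]
  right_inv' Q hQ := by
    exact congrArg Fiber.val (fiberMap_fiberMapInv hQ ⟨Q, rfl⟩)

theorem isEmbeddedAtlas_idempotents :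
    IsEmbeddedAtlas (Subtype.val : idempotents ℂ H → H →L[ℂ] H)
      (BanachChart.toReal '' submanifoldAtlas ℂ (idempotents ℂ H)) :=
  isEmbeddedAtlas_submanifoldAtlas exists_mem_submanifoldAtlas_idempotents

theorem isAnalyticMapOn_rangeMap :
    IsAnalyticMapOn (BanachChart.toReal '' submanifoldAtlas ℂ (idempotents ℂ H))
      (BanachChart.toReal '' atlas ℂ H) (rangeMap (𝕜 := ℂ) (X := H)) univ :=
  isEmbeddedAtlas_idempotents.isAnalyticMapOn isEmbeddedAtlas_proj isOpen_univ
    analyticOnNhd_orthogonalize (fun Q _ => isUnit_add_star_sub_one Q) fun Q _ => proj_rangeMap Q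

theorem isAnalyticMapOn_triv (E : Grassmannian ℂ H) :
    IsAnalyticMapOn
      (prodAtlas (BanachChart.toReal '' atlas ℂ H)
        (modelAtlas ℝ (Fiber (rangeMap (𝕜 := ℂ) (X := H)) E)))
      (BanachChart.toReal '' submanifoldAtlas ℂ (idempotents ℂ H)) (triv E)
      (trivSet E ×ˢ univ) := by
  refine (isEmbeddedAtlas_proj.prod (IsEmbeddedAtlas.model _)).isAnalyticMapOn
    isEmbeddedAtlas_idempotents ((isOpen_trivSet E).prod isOpen_univ)
    -- Conjugation of an idempotent over `E` by the frame, with the orthogonal projection `proj F`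
    -- replaced by an arbitrary operator variable.
    (G := fun p => frame E p.1 * (proj E + fiberIncl E p.2) * coframe E p.1)
    (O := {X | IsUnit (frame E X)} ×ˢ univ) ?_ (fun p hp => hp) ?_
  · intro p hp
    have h1 := (analyticAt_frame E p.1).fun_comp (analyticAt_fst (p := p))
    have h2 := (analyticAt_coframe E hp.1).fun_comp (analyticAt_fst (p := p))
    have h3 : AnalyticAt ℝ (fiberIncl E) p.2 :=
      ((fiberIncl E).toContinuousLinearMap.analyticAt p.2).restrictScalars
    have h4 := h3.fun_comp (analyticAt_snd (p := p))
    exact (h1.mul (analyticAt_const.add h4)).mul h2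
  · rintro ⟨F, x⟩ hp
    exact Fiber.val_fiberConj (frame_mul_coframe hp.1) (proj_mul_frame E F)
      (coframe_mul_proj hp.1) x

theorem isAnalyticMapOn_triv_symm (E : Grassmannian ℂ H) :
    IsAnalyticMapOn (BanachChart.toReal '' submanifoldAtlas ℂ (idempotents ℂ H))
      (prodAtlas (BanachChart.toReal '' atlas ℂ H)
        (modelAtlas ℝ (Fiber (rangeMap (𝕜 := ℂ) (X := H)) E)))
      (triv E).symm (rangeMap ⁻¹' trivSet E) := by
  refine isEmbeddedAtlas_idempotents.isAnalyticMapOn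
    (isEmbeddedAtlas_proj.prod (IsEmbeddedAtlas.model _))
    ((isOpen_trivSet E).preimage
      (continuousOn_univ.1 isAnalyticMapOn_rangeMap.continuousOn))
    -- The base coordinate is $P=$ `orthogonalize Q`; the fiber coordinate conjugates the
    -- displacement $Q-P$ back to `E` by the frame at $P$.
    (G := fun Q => (orthogonalize Q, toFiber E (coframe E (orthogonalize Q) *
      (Q - orthogonalize Q) * frame E (orthogonalize Q))))
    (O := {Q | IsUnit (Q + star Q - 1) ∧ IsUnit (frame E (orthogonalize Q))}) ?_ ?_ ?_
  · rintro Q ⟨h, h'⟩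
    have h1 := analyticOnNhd_orthogonalize Q h
    have h2 := (analyticAt_coframe E h').fun_comp h1
    have h3 := (analyticAt_frame E _).fun_comp h1
    have h4 : ∀ X, AnalyticAt ℝ (toFiber E) X := fun X => ((toFiber E).analyticAt X).restrictScalars
    exact h1.prod ((h4 _).fun_comp ((h2.mul (analyticAt_id.sub h1)).mul h3))
  · intro Q hQ
    refine ⟨isUnit_add_star_sub_one Q, ?_⟩
    rw [← proj_rangeMap]
    exact hQ
  · intro Q hQ
    rw [← proj_rangeMap]
    rfl

theorem exists_analytic_transition (E F : Grassmannian ℂ H) :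
    ∃ φ : Grassmannian ℂ H → (Fiber (rangeMap (𝕜 := ℂ) (X := H)) E →L[ℂ]
        Fiber (rangeMap (𝕜 := ℂ) (X := H)) F),
      (∀ G ∈ trivSet E ∩ trivSet F, ∀ x, φ G x = ((triv F).symm (triv E (G, x))).2) ∧
      IsAnalyticMapOn (BanachChart.toReal '' atlas ℂ H)
        (modelAtlas ℝ (Fiber (rangeMap (𝕜 := ℂ) (X := H)) E →L[ℂ]
          Fiber (rangeMap (𝕜 := ℂ) (X := H)) F)) φ (trivSet E ∩ trivSet F) := by
  -- Going from `E` to `G` and then to `F` composes two conjugations, with left factor $U_F^{-1}U_E$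
  -- and right factor its inverse $U_E^{-1}U_F$.
  refine ⟨fun G => fiberConj E F (coframe F (proj G) * frame E (proj G))
    (coframe E (proj G) * frame F (proj G)), fun G hG x => ?_, ?_⟩
  · have h : ((triv F).symm (triv E (G, x))).2 = fiberMapInv F G (fiberMap E G x) :=
      fiberCoord_val F _
    rw [h, fiberMapInv, fiberMap,
      fiberConj_fiberConj (proj_mul_frame E G) (coframe_mul_proj hG.1)]
  · refine isEmbeddedAtlas_proj.isAnalyticMapOn (IsEmbeddedAtlas.model _)
      ((isOpen_trivSet E).inter (isOpen_trivSet F))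
      (G := fun X => fiberConj E F (coframe F X * frame E X) (coframe E X * frame F X))
      (O := {X | IsUnit (frame E X) ∧ IsUnit (frame F X)}) ?_ (fun _ h => h) fun _ _ => rfl
    rintro X ⟨hE, hF⟩
    have h : AnalyticAt ℝ
        (fun X => (coframe F X * frame E X, coframe E X * frame F X)) X :=
      ((analyticAt_coframe F hF).mul (analyticAt_frame E X)).prod
        ((analyticAt_coframe E hE).mul (analyticAt_frame F X))
    exact AnalyticAt.comp (g := fun p : (H →L[ℂ] H) × (H →L[ℂ] H) => fiberConj E F p.1 p.2)
      (f := fun X => (coframe F X * frame E X, coframe E X * frame F X)) (x := X)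
      (analyticOnNhd_fiberConj E F _ (mem_univ _)) h

/-- The orthogonal projection, as the zero of the fiber, witnesses that each fiber is nonempty. -/
theorem rangeMap_surjective : Function.Surjective (rangeMap (𝕜 := ℂ) (X := H)) :=
  fun E => ⟨(0 : Fiber (rangeMap (𝕜 := ℂ) (X := H)) E).val, Fiber.map_val _⟩

theorem isRealAnalyticComplexBanachBundle_rangeMap :
    IsRealAnalyticComplexBanachBundle
      (BanachChart.toReal '' submanifoldAtlas ℂ (idempotents ℂ H))
      (BanachChart.toReal '' atlas ℂ H) (rangeMap (𝕜 := ℂ) (X := H)) :=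
  ⟨inferInstance, inferInstance, isEmbeddedAtlas_idempotents.isAnalyticAtlas,
    isEmbeddedAtlas_proj.isAnalyticAtlas, rangeMap_surjective, isAnalyticMapOn_rangeMap,
    Fiber.isInducing_val, trivSet, triv,
    fun E => ⟨isOpen_trivSet E, mem_trivSet_self E, rfl, rfl, isAnalyticMapOn_triv E,
      isAnalyticMapOn_triv_symm E, fun F hF => ⟨(fiberMap E F).toLinearMap,
        fun y => ⟨fiberMapInv E F y, fiberMap_fiberMapInv hF y⟩, fun _ => rfl⟩⟩,
    exists_analytic_transition⟩

theorem val_zero_fiber (E : Grassmannian ℂ H) :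
    ((0 : Fiber (rangeMap (𝕜 := ℂ) (X := H)) E).val : H →L[ℂ] H) = E.space.starProjection := by
  rw [Fiber.val_eq, map_zero, add_zero]
  rfl

end Trivialization

/-- The last conjunct says that, for the atlas of the Banach submanifold of all idempotents and the
atlas of the Grassmann manifold, seen as real analytic atlases, the map `rangeMap` is a
locally trivial real analytic complex Banach bundle. -/
theorem mainTheorem9 (H : Type u) [NormedAddCommGroup H] [InnerProductSpace ℂ H]
    [CompleteSpace H] :
    ∃ (_ : ∀ E : Grassmannian ℂ H, NormedAddCommGroup (Fiber (rangeMap (𝕜 := ℂ) (X := H)) E))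
      (_ : ∀ E : Grassmannian ℂ H, NormedSpace ℂ (Fiber (rangeMap (𝕜 := ℂ) (X := H)) E))
      (_ : ∀ E : Grassmannian ℂ H, CompleteSpace (Fiber (rangeMap (𝕜 := ℂ) (X := H)) E)),
      (∀ E : Grassmannian ℂ H,
        ((0 : Fiber (rangeMap (𝕜 := ℂ) (X := H)) E).val : H →L[ℂ] H) =
          E.space.starProjection) ∧
      (∀ E : Grassmannian ℂ H,
        ∃ f : Fiber (rangeMap (𝕜 := ℂ) (X := H)) E →ᵃⁱ[ℂ] (H →L[ℂ] H),
          ∀ x, f x = (x.val : H →L[ℂ] H)) ∧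
      IsRealAnalyticComplexBanachBundle
        (BanachChart.toReal '' submanifoldAtlas ℂ (idempotents ℂ H))
        (BanachChart.toReal '' Grassmannian.atlas ℂ H)
        (rangeMap (𝕜 := ℂ) (X := H)) := by
  exact ⟨fiberNormedAddCommGroup, fiberNormedSpace, completeSpace_fiber, val_zero_fiber,
    fun E => ⟨fiberAffineIsometry E, fiberAffineIsometry_apply⟩,
    isRealAnalyticComplexBanachBundle_rangeMap⟩
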